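/- Setting. Let $L>0$ and $1<p<\infty$. For every $s\in[0,L]$ let $\mathcal A(s)\subset\mathbb R^2$ be a compact simply connected set with $0$ in its interior, such that for some $R>0$ one has $|\zeta_1|<R$ and $|\zeta_2|<R$ for all $s\in[0,L]$ and $(\zeta_1,\zeta_2)\in\mathcal A(s)$, and such that $$\Omega:=\{(s,\zeta_1,\zeta_2): s\in[0,L],\ (\zeta_1,\zeta_2)\in\mathcal A(s)\}$$ is Lebesgue measurable. Let $f:\mathbb R^3\times[0,L]\to\mathbb R\cup\{+\infty\}$ be continuous and convex in the first variable, measurable in the second, with $f(a,s)\ge C_1|a|^p+C_2$ for some $C_1>0$, $C_2\in\mathbb R$; let $\rho:\Omega\to(0,\infty)$ be integrable and $g\in\mathbb R^3$. For $\mathsf w=((\kappa_1,\kappa_2,\omega),x_0,t_0,d_0)\in V:=L^p([0,L];\mathbb R^3)\times\mathbb R^3\times\mathbb R^3\times\mathbb R^3$ let $x,t,d:[0,L]\to\mathbb R^3$ be the unique absolutely continuous solution of $$x'=t,\qquad t'=\kappa_2\,d-\kappa_1\,t\times d,\qquad d'=\omega\,t\times d-\kappa_2\,t\qquad\text{a.e.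 in }[0,L],$$ $$x(0)=x_0,\quad t(0)=t_0,\quad d(0)=d_0,$$ and define the configuration map on $\Omega$ by $$p[\mathsf w](s,\zeta_1,\zeta_2):=x(s)+\zeta_1\,d(s)+\zeta_2\,t(s)\times d(s).$$ The energy of the loop is $$E_{\rm loop}(\mathsf w):=\int_0^L f\big((\kappa_1,\kappa_2,\omega)(s),s\big)\,ds+E_{\rm ni}(\mathsf w)-\int_\Omega\rho\; g\cdot p[\mathsf w]\,d(s,\zeta_1,\zeta_2),$$ where $E_{\rm ni}(\mathsf w)=0$ if for almost every $s\in[0,L]$ $$\max_{(\zeta_1,\zeta_2)\in\mathcal A(s)}\big(\zeta_1\kappa_2(s)-\zeta_2\kappa_1(s)\big)\le 1,$$ and $E_{\rm ni}(\mathsf w)=+\infty$ otherwise. Theorem. Let $\mathsf w\in V$ with $|t_0|=|d_0|=1$, $t_0\cdot d_0=0$ and $E_{\rm loop}(\mathsf w)<+\infty$. Then $p[\mathsf w]$ is locally injective on $\mathrm{int}(\Omega)$, and it is an open map on $\mathrm{int}(\Omega)$. If, in addition, $$\int_\Omega\big(1-\zeta_1\kappa_2(s)+\zeta_2\kappa_1(s)\big)\,d(s,\zeta_1,\zeta_2)\le\mathcal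 H^3\big(p[\mathsf w](\Omega)\big),$$ where $\mathcal H^3$ is the three-dimensional Hausdorff measure (normalized so as to equal Lebesgue measure on $\mathbb R^3$), then $p[\mathsf w]$ is injective on $\mathrm{int}(\Omega)$. -/

import Mathlib

open MeasureTheory
open scoped ENNReal

/-- Three-dimensional Euclidean space. -/
abbrev E3 : Type := EuclideanSpace ℝ (Fin 3)

/-- The vector product of Euclidean three-space. -/
def vecCross (a b : E3) : E3 :=
  WithLp.toLp 2 (crossProduct (WithLp.ofLp a) (WithLp.ofLp b))

/-- The integral over a set of an extended-real-valued function, as the difference of the integrals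
of its positive and negative parts (used only for integrands bounded below on a bounded interval,
so that the second integral is finite). -/
noncomputable def erealIntegral (S : Set ℝ) (h : ℝ → EReal) : EReal :=
  ((∫⁻ s in S, (h s).toENNReal : ℝ≥0∞) : EReal) - ((∫⁻ s in S, (-h s).toENNReal : ℝ≥0∞) : EReal)

/-- The data of the model: length and cross-sections of the rod, the integrability exponent,
the density of elastic energy, the mass density, and the gravitational acceleration. -/
structure KirchhoffRod where
  /-- total length of the midline -/
  L : ℝ
  L_pos : 0 < L
  /-- integrability exponent of the densities -/
  p : ℝ
  one_lt_p : 1 < p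
  /-- the material cross-section at `s` (only the values for `s ∈ [0, L]` matter) -/
  A : ℝ → Set (ℝ × ℝ)
  isCompact_A : ∀ s ∈ Set.Icc 0 L, IsCompact (A s)
  simplyConnected_A : ∀ s ∈ Set.Icc 0 L, SimplyConnectedSpace (A s)
  zero_mem_interior_A : ∀ s ∈ Set.Icc 0 L, (0 : ℝ × ℝ) ∈ interior (A s)
  /-- the cross-sections are uniformly bounded -/
  bounded_A : ∃ R > 0, ∀ s ∈ Set.Icc 0 L, ∀ ζ ∈ A s, |ζ.1| < R ∧ |ζ.2| < R
  /-- the reference configuration is Lebesgue measurable -/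
  nullMeasurable_A :
    NullMeasurableSet {q : ℝ × ℝ × ℝ | q.1 ∈ Set.Icc 0 L ∧ q.2 ∈ A q.1} volume
  /-- density of elastic energy `f(a, s)` -/
  f : E3 → ℝ → EReal
  continuous_f : ∀ s ∈ Set.Icc 0 L, Continuous fun a => f a s
  convex_f : ∀ s ∈ Set.Icc 0 L, ∀ a b : E3, ∀ θ ∈ Set.Icc (0 : ℝ) 1,
    f (θ • a + (1 - θ) • b) s ≤ (θ : EReal) * f a s + ((1 - θ : ℝ) : EReal) * f b s
  measurable_f : ∀ a, AEMeasurable (f a) (volume.restrict (Set.Icc 0 L))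
  /-- growth condition; in particular `f` is bounded below and never takes the value `-∞` -/
  growth_f : ∃ C₁ > 0, ∃ C₂ : ℝ, ∀ a : E3, ∀ s ∈ Set.Icc 0 L,
    ((C₁ * ‖a‖ ^ p + C₂ : ℝ) : EReal) ≤ f a s
  /-- mass density -/
  ρ : ℝ × ℝ × ℝ → ℝ
  ρ_pos : ∀ q : ℝ × ℝ × ℝ, q.1 ∈ Set.Icc 0 L → q.2 ∈ A q.1 → 0 < ρ q
  /-- the total mass is finite -/
  integrable_ρ : IntegrableOn ρ {q : ℝ × ℝ × ℝ | q.1 ∈ Set.Icc 0 L ∧ q.2 ∈ A q.1} volume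
  /-- gravitational acceleration -/
  g : E3

/-- `x`, `t`, `d` solve, in the sense of Carathéodory, the Cauchy problem
`x' = t`, `t' = κ₂ d - κ₁ (t × d)`, `d' = ω (t × d) - κ₂ t` on `[0, L]`,
`x 0 = x₀`, `t 0 = t₀`, `d 0 = d₀`, where `κ s = (κ₁ s, κ₂ s, ω s)`.
For integrable coefficients the integral equations say that `x`, `t`, `d` are absolutely continuous
and satisfy the differential equations almost everywhere. -/
structure IsRodSolution (L : ℝ) (κ : ℝ → E3) (x₀ t₀ d₀ : E3) (x t d : ℝ → E3) : Prop where
  continuousOn_x : ContinuousOn x (Set.Icc 0 L)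
  continuousOn_t : ContinuousOn t (Set.Icc 0 L)
  continuousOn_d : ContinuousOn d (Set.Icc 0 L)
  eq_x : ∀ s ∈ Set.Icc 0 L, x s = x₀ + ∫ σ in (0 : ℝ)..s, t σ
  eq_t : ∀ s ∈ Set.Icc 0 L,
    t s = t₀ + ∫ σ in (0 : ℝ)..s, (κ σ 1 • d σ - κ σ 0 • vecCross (t σ) (d σ))
  eq_d : ∀ s ∈ Set.Icc 0 L,
    d s = d₀ + ∫ σ in (0 : ℝ)..s, (κ σ 2 • vecCross (t σ) (d σ) - κ σ 1 • t σ)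

namespace KirchhoffRod

variable (M : KirchhoffRod)

/-- The space `V = Lᵖ([0, L]; ℝ³) × ℝ³ × ℝ³ × ℝ³` of elements `w = ((κ₁, κ₂, ω), x₀, t₀, d₀)`. -/
abbrev V : Type :=
  Lp E3 (ENNReal.ofReal M.p) (volume.restrict (Set.Icc 0 M.L)) × E3 × E3 × E3

variable {M}

/-- The triple of densities `(κ₁, κ₂, ω)` (a representative of the class in `Lᵖ`). -/
noncomputable def density (w : M.V) : ℝ → E3 := w.1

/-- first flexural density -/
noncomputable def κ₁ (w : M.V) (s : ℝ) : ℝ := density w s 0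

/-- second flexural density -/
noncomputable def κ₂ (w : M.V) (s : ℝ) : ℝ := density w s 1

/-- clamping parameters -/
def x₀ (w : M.V) : E3 := w.2.1

/-- clamping parameters -/
def t₀ (w : M.V) : E3 := w.2.2.1

/-- clamping parameters -/
def d₀ (w : M.V) : E3 := w.2.2.2

/-- The solution `(x[w], t[w], d[w])` of the Cauchy problem; it exists and is unique on `[0, L]`
(its values outside `[0, L]` are never used). -/
noncomputable def solution (w : M.V) : (ℝ → E3) × (ℝ → E3) × (ℝ → E3) :=
  Classical.epsilon fun y =>
    IsRodSolution M.L (density w) (x₀ w) (t₀ w) (d₀ w) y.1 y.2.1 y.2.2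

/-- the midline `x[w]` -/
noncomputable def midline (w : M.V) : ℝ → E3 := (solution w).1

/-- the tangent field `t[w]` -/
noncomputable def tangent (w : M.V) : ℝ → E3 := (solution w).2.1

/-- the director field `d[w]` -/
noncomputable def director (w : M.V) : ℝ → E3 := (solution w).2.2

variable (M) in
/-- The reference set `Ω = {(s, ζ₁, ζ₂) : s ∈ [0, L], (ζ₁, ζ₂) ∈ A(s)}`. -/
def Ω : Set (ℝ × ℝ × ℝ) := {q | q.1 ∈ Set.Icc 0 M.L ∧ q.2 ∈ M.A q.1}

/-- The configuration map `p[w](s, ζ₁, ζ₂) = x(s) + ζ₁ d(s) + ζ₂ (t(s) × d(s))`. -/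
noncomputable def config (w : M.V) (q : ℝ × ℝ × ℝ) : E3 :=
  midline w q.1 + q.2.1 • director w q.1 + q.2.2 • vecCross (tangent w q.1) (director w q.1)

/-- The set `N` of the `w` satisfying the local non-interpenetration constraint. -/
def N : Set M.V :=
  {w | ∀ᵐ s ∂(volume.restrict (Set.Icc 0 M.L)), ∀ ζ ∈ M.A s, ζ.1 * κ₂ w s - ζ.2 * κ₁ w s ≤ 1}

/-- shape energy -/
noncomputable def Esh (w : M.V) : EReal :=
  erealIntegral (Set.Icc 0 M.L) fun s => M.f (density w s) s

open Classical in
/-- non-interpenetration term: the indicator function of `N` -/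
noncomputable def Eni (w : M.V) : EReal := if w ∈ N (M := M) then 0 else ⊤

/-- potential energy of the weight -/
noncomputable def Eg (w : M.V) : ℝ := -∫ q in M.Ω, M.ρ q * inner ℝ M.g (config w q)

/-- total energy of the bounding loop -/
noncomputable def Eloop (w : M.V) : EReal := Esh w + Eni w + (Eg w : EReal)

/-- The integral global injectivity condition
`∫_Ω (1 - ζ₁ κ₂(s) + ζ₂ κ₁(s)) d(s, ζ₁, ζ₂) ≤ H³(p[w](Ω))`, with `H³` the three-dimensional
Hausdorff measure in its usual normalization (equal to Lebesgue measure on `ℝ³`). -/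
def GlobInj (w : M.V) : Prop :=
  ENNReal.ofReal (∫ q in M.Ω, (1 - q.2.1 * κ₂ w q.1 + q.2.2 * κ₁ w q.1)) ≤
    Measure.euclideanHausdorffMeasure 3 (config w '' M.Ω)

end KirchhoffRod

/-! For a point `y` of space, consider its height over the moving cross-sectional plane, `h_y(s) =
t(s) · (y - x(s))`. It vanishes exactly when `y` lies in the plane at `s`, and then `y` is the image
of `(s, ζ₁, ζ₂)` with `ζ₁ = d · (y - x)`, `ζ₂ = n · (y - x)`, `n = t × d`. The frame equations give
`h_y' = -(1 - ζ₁ κ₂ + ζ₂ κ₁)`, minus the Jacobian of the configuration map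
(`IsRodFrame.prim_height`).

Finite energy forces the local constraint, so this Jacobian is nonnegative on `A(s)` for almost
every `s`. Near an interior point of `Ω` more is true: a linear form bounded by `1` on a box is
bounded by `1 - c` on a smaller box, with `c` independent of the form (`div_add_le_one_sub`). Hence
`h_y` decreases at a uniform rate although the curvatures are merely integrable
(`exists_height_decreasing`). A decreasing function has at most one zero, which gives local
injectivity; it changes sign across the zero, stably in `y`, and the intermediate value theorem
gives openness.

For global injectivity, suppose that two interior points have the same image. By openness a whole
neighbourhood `U` of one of them is covered by the image of the rest, so `Ω \ U` has the same image
as `Ω`. The volume of an image is at most the integral of the Jacobian, so the volume hypothesis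
forces this integral to vanish over `U`; then the image of `U` is null, although it is a
neighbourhood of a point. The volume bound is the change-of-variables inequality where the map is
differentiable, together with Luzin's property N for the exceptional null set of arc lengths.

Two preliminaries: the Cauchy problem must be solvable for the chosen solution to mean anything, and
every solution must be an orthonormal frame. -/

open Filter Topology Set

/-! ### Linear Volterra equations with integrable kernel -/

/-- An integrable nonnegative function exceeds large constants only by a small amount in mean. -/
lemma exists_integral_posPart_sub_le {a : ℝ → ℝ} (ha : Integrable a) (h0 : ∀ s, 0 ≤ a s) {ε : ℝ}
    (hε : 0 < ε) : ∃ K > 0, ∫ s, max (a s - K) 0 ≤ ε := by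
  have h : Tendsto (fun n : ℕ => ∫ s, max (a s - n) 0) atTop (𝓝 (∫ _ : ℝ, (0 : ℝ))) := by
    refine tendsto_integral_of_dominated_convergence a (fun n => ?_) ha (fun n => ?_) ?_
    · exact (ha.aestronglyMeasurable.sub aestronglyMeasurable_const).sup aestronglyMeasurable_const
    · refine .of_forall fun s => ?_
      rw [Real.norm_of_nonneg (le_max_right _ _)]
      exact max_le (by linarith [(Nat.cast_nonneg n : (0 : ℝ) ≤ n)]) (h0 s)
    · refine .of_forall fun s => tendsto_const_nhds.congr' ?_
      obtain ⟨N, hN⟩ := exists_nat_ge (a s)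
      filter_upwards [eventually_ge_atTop N] with n hn
      have : (N : ℝ) ≤ n := by exact_mod_cast hn
      rw [max_eq_right (by linarith)]
  rw [integral_zero] at h
  obtain ⟨n, hn, hn0⟩ := ((h.eventually (ge_mem_nhds hε)).and (eventually_gt_atTop 0)).exists
  exact ⟨n, by exact_mod_cast hn0, hn⟩

section Volterra

variable {E : Type*} [NormedAddCommGroup E] [NormedSpace ℝ E]

lemma intervalIntegrable_clm_apply {A : ℝ → E →L[ℝ] E} (hA : Integrable A) {v : ℝ → E}
    (hv : Continuous v) (a b : ℝ) : IntervalIntegrable (fun r => A r (v r)) volume a b := by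
  obtain ⟨C, hC⟩ := (isCompact_uIcc (a := a) (b := b)).exists_bound_of_continuousOn hv.continuousOn
  rw [intervalIntegrable_iff]
  refine Integrable.mono' (g := fun r => ‖A r‖ * C) (hA.norm.mul_const C).integrableOn ?_ ?_
  · exact ((ContinuousLinearMap.apply ℝ E).flip.aestronglyMeasurable_comp₂
      hA.aestronglyMeasurable hv.aestronglyMeasurable).restrict
  · refine (ae_restrict_iff' measurableSet_uIoc).2 (.of_forall fun r hr => ?_)
    exact (A r).le_of_opNorm_le_of_le le_rfl (hC r (uIoc_subset_uIcc hr))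

/-- Linear Volterra equations with integrable kernel are solvable. -/
theorem exists_continuous_eq_add_integral [CompleteSpace E] {A : ℝ → E →L[ℝ] E}
    (hA : Integrable A) {L : ℝ} (hL : 0 ≤ L) (u₀ : E) :
    ∃ u : ℝ → E, Continuous u ∧ ∀ s ∈ Icc 0 L, u s = u₀ + ∫ r in (0 : ℝ)..s, A r (u r) := by
  -- Split `‖A‖ ≤ K + (‖A‖ - K)⁺`. The weight `exp (4 * K * s)` makes the constant part contribute a
  -- factor `1/4`, and `K` is taken so large that the excess contributes another `1/4`; together the
  -- contraction factor is `1/2`.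
  obtain ⟨K, hK, hKA⟩ := exists_integral_posPart_sub_le hA.norm (fun s => norm_nonneg (A s))
    (ε := 1 / 4) (by norm_num)
  have hexp : Continuous fun r : ℝ => Real.exp (4 * K * r) := by fun_prop
  let ext : C(Icc 0 L, E) → ℝ → E := fun v => IccExtend hL v
  have hext : ∀ v, Continuous (ext v) := fun v => v.continuous.Icc_extend'
  have hw : ∀ v, Continuous fun r => Real.exp (4 * K * r) • ext v r :=
    fun v => hexp.smul (hext v)
  let I : C(Icc 0 L, E) → ℝ → E :=
    fun v s => u₀ + ∫ r in (0 : ℝ)..s, A r (Real.exp (4 * K * r) • ext v r)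
  have hI : ∀ v, Continuous (I v) := fun v => continuous_const.add
    (intervalIntegral.continuous_primitive (fun a b => intervalIntegrable_clm_apply hA (hw v) a b) 0)
  -- The unknown is `v = exp (-4 K s) u`, so the sup norm of `v` is a weighted norm of `u` and one
  -- contraction covers the whole interval.
  let Φ : C(Icc 0 L, E) → C(Icc 0 L, E) := fun v =>
    ⟨fun s => Real.exp (-(4 * K * s)) • I v s, by
      have := hI v
      fun_prop⟩
  have hΦ : ContractingWith (1 / 2) Φ := by
    refine ⟨by norm_num [← NNReal.coe_lt_coe], LipschitzWith.of_dist_le_mul fun v w => ?_⟩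
    rw [ContinuousMap.dist_le (by positivity)]
    rintro ⟨s, hs⟩
    have hvw : ∀ r, ‖ext v r - ext w r‖ ≤ dist v w := fun r => by
      rw [← dist_eq_norm]; exact ContinuousMap.dist_apply_le_dist _
    have hsub : I v s - I w s = ∫ r in (0 : ℝ)..s, A r (Real.exp (4 * K * r) • (ext v r - ext w r)) := by
      simp only [I, add_sub_add_left_eq_sub]
      rw [← intervalIntegral.integral_sub (intervalIntegrable_clm_apply hA (hw v) 0 s)
        (intervalIntegrable_clm_apply hA (hw w) 0 s)]
      simp only [smul_sub, map_sub]
    have hm : Integrable fun r => max (‖A r‖ - K) 0 :=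
      Integrable.mono' hA.norm
        ((hA.norm.aestronglyMeasurable.sub aestronglyMeasurable_const).sup aestronglyMeasurable_const)
        (.of_forall fun r => by
          rw [Real.norm_of_nonneg (le_max_right _ _)]
          exact max_le (by linarith) (norm_nonneg _))
    have hint1 : IntervalIntegrable (fun r => K * Real.exp (4 * K * r)) volume 0 s :=
      (hexp.const_mul K |>.intervalIntegrable 0 s)
    have hint2 : IntervalIntegrable (fun r => Real.exp (4 * K * s) * max (‖A r‖ - K) 0) volume 0 s :=
      (hm.const_mul _).intervalIntegrable
    have hbound : ‖I v s - I w s‖ ≤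
        ∫ r in (0 : ℝ)..s, (K * Real.exp (4 * K * r) + Real.exp (4 * K * s) * max (‖A r‖ - K) 0)
          * dist v w := by
      rw [hsub]
      refine intervalIntegral.norm_integral_le_of_norm_le hs.1 ?_ ((hint1.add hint2).mul_const _)
      refine .of_forall fun r hr => ?_
      refine ((A r).le_of_opNorm_le_of_le le_rfl (norm_smul_le _ _)).trans ?_
      rw [Real.norm_of_nonneg (Real.exp_pos _).le, ← mul_assoc]
      refine mul_le_mul ?_ (hvw r) (norm_nonneg _) (by positivity)
      have h1 : ‖A r‖ ≤ K + max (‖A r‖ - K) 0 := by linarith [le_max_left (‖A r‖ - K) 0]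
      have h2 : Real.exp (4 * K * r) ≤ Real.exp (4 * K * s) :=
        Real.exp_le_exp.2 (mul_le_mul_of_nonneg_left hr.2 (by positivity))
      calc ‖A r‖ * Real.exp (4 * K * r) ≤ (K + max (‖A r‖ - K) 0) * Real.exp (4 * K * r) := by gcongr
        _ ≤ _ := by
          rw [add_mul, mul_comm (max _ _)]
          gcongr
    have hval1 : ∫ r in (0 : ℝ)..s, K * Real.exp (4 * K * r) ≤ Real.exp (4 * K * s) / 4 := by
      have hd : ∀ r ∈ uIcc 0 s, HasDerivAt (fun r => Real.exp (4 * K * r) / 4)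
          (K * Real.exp (4 * K * r)) r := fun r _ => by
        have := (((hasDerivAt_id r).const_mul (4 * K)).exp).div_const 4
        exact this.congr_deriv (by simp only [id]; ring)
      rw [intervalIntegral.integral_eq_sub_of_hasDerivAt hd hint1]
      have := Real.exp_pos (4 * K * 0)
      linarith
    have hval2 : ∫ r in (0 : ℝ)..s, max (‖A r‖ - K) 0 ≤ 1 / 4 := by
      rw [intervalIntegral.integral_of_le hs.1]
      exact (setIntegral_le_integral hm (.of_forall fun r => le_max_right _ _)).trans hKA
    rw [intervalIntegral.integral_mul_const, intervalIntegral.integral_add hint1 hint2] at hbound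
    have hΦs : dist (Φ v ⟨s, hs⟩) (Φ w ⟨s, hs⟩) = Real.exp (-(4 * K * s)) * ‖I v s - I w s‖ := by
      rw [dist_eq_norm]
      change ‖Real.exp (-(4 * K * s)) • I v s - Real.exp (-(4 * K * s)) • I w s‖ = _
      rw [← smul_sub, norm_smul, Real.norm_of_nonneg (Real.exp_pos _).le]
    rw [hΦs]
    have hd0 : 0 ≤ dist v w := dist_nonneg
    have hE := Real.exp_pos (4 * K * s)
    calc Real.exp (-(4 * K * s)) * ‖I v s - I w s‖
        ≤ Real.exp (-(4 * K * s)) * ((Real.exp (4 * K * s) / 4 + Real.exp (4 * K * s) * (1 / 4))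
            * dist v w) := by
          refine mul_le_mul_of_nonneg_left (hbound.trans ?_) (Real.exp_pos _).le
          gcongr
          rw [intervalIntegral.integral_const_mul]
          gcongr
      _ = ((1 / 2 : NNReal) : ℝ) * dist v w := by
          rw [Real.exp_neg]; push_cast; field_simp; ring
  have : Nonempty C(Icc 0 L, E) := ⟨0⟩
  set v := hΦ.fixedPoint Φ with hv
  have hfix : Φ v = v := hΦ.fixedPoint_isFixedPt
  refine ⟨fun r => Real.exp (4 * K * r) • ext v r, hw v, fun s hs => ?_⟩
  change Real.exp (4 * K * s) • ext v s = I v s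
  have h1 : ext v s = v ⟨s, hs⟩ := IccExtend_of_mem hL _ hs
  have h2 : v ⟨s, hs⟩ = Real.exp (-(4 * K * s)) • I v s := by
    conv_lhs => rw [← hfix]
    rfl
  rw [h1, h2, smul_smul, ← Real.exp_add, add_neg_cancel, Real.exp_zero, one_smul]

end Volterra

/-! ### Calculus of absolutely continuous functions and vector fields -/

/-- `u` is absolutely continuous on the interval between `a` and `b`, with derivative `u'`
almost everywhere. -/
structure IsPrimitiveOn (u u' : ℝ → ℝ) (a b : ℝ) : Prop where
  ac : AbsolutelyContinuousOnInterval u a b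
  hasDerivAt : ∀ᵐ s, s ∈ uIcc a b → HasDerivAt u (u' s) s

namespace IsPrimitiveOn

variable {u v u' v' w' : ℝ → ℝ} {a b c d : ℝ}

lemma congr_deriv (h : IsPrimitiveOn u u' a b) (e : ∀ s ∈ uIcc a b, u' s = w' s) :
    IsPrimitiveOn u w' a b :=
  ⟨h.ac, by filter_upwards [h.hasDerivAt] with s hs hm using e s hm ▸ hs hm⟩

lemma congr_fun (h : IsPrimitiveOn u u' a b) (e : ∀ s, u s = v s) : IsPrimitiveOn v u' a b :=
  funext e ▸ h

lemma add (hu : IsPrimitiveOn u u' a b) (hv : IsPrimitiveOn v v' a b) :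
    IsPrimitiveOn (fun s => u s + v s) (fun s => u' s + v' s) a b :=
  ⟨hu.ac.add hv.ac, by
    filter_upwards [hu.hasDerivAt, hv.hasDerivAt] with s h₁ h₂ hm using (h₁ hm).add (h₂ hm)⟩

lemma sub (hu : IsPrimitiveOn u u' a b) (hv : IsPrimitiveOn v v' a b) :
    IsPrimitiveOn (fun s => u s - v s) (fun s => u' s - v' s) a b :=
  ⟨hu.ac.sub hv.ac, by
    filter_upwards [hu.hasDerivAt, hv.hasDerivAt] with s h₁ h₂ hm using (h₁ hm).sub (h₂ hm)⟩

lemma mul (hu : IsPrimitiveOn u u' a b) (hv : IsPrimitiveOn v v' a b) :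
    IsPrimitiveOn (fun s => u s * v s) (fun s => u' s * v s + u s * v' s) a b :=
  ⟨hu.ac.mul hv.ac, by
    filter_upwards [hu.hasDerivAt, hv.hasDerivAt] with s h₁ h₂ hm using (h₁ hm).mul (h₂ hm)⟩

lemma const (k a b : ℝ) : IsPrimitiveOn (fun _ => k) (fun _ => 0) a b :=
  ⟨((LipschitzWith.const k).lipschitzOnWith (s := uIcc a b)).absolutelyContinuousOnInterval,
    .of_forall fun s _ => hasDerivAt_const s k⟩

lemma pow_two (hu : IsPrimitiveOn u u' a b) :
    IsPrimitiveOn (fun s => u s ^ 2) (fun s => 2 * u s * u' s) a b :=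
  ((hu.mul hu).congr_deriv fun s _ => by ring).congr_fun fun s => by ring

lemma mono (h : IsPrimitiveOn u u' a b) (hcd : uIcc c d ⊆ uIcc a b) : IsPrimitiveOn u u' c d :=
  ⟨h.ac.mono hcd, by filter_upwards [h.hasDerivAt] with s hs hm using hs (hcd hm)⟩

lemma deriv_ae_eq (h : IsPrimitiveOn u u' a b) :
    deriv u =ᵐ[volume.restrict (uIoc a b)] u' := by
  refine (ae_restrict_iff' measurableSet_uIoc).2 ?_
  filter_upwards [h.hasDerivAt] with s hs hm using (hs (uIoc_subset_uIcc hm)).deriv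

lemma intervalIntegrable (h : IsPrimitiveOn u u' a b) : IntervalIntegrable u' volume a b :=
  h.ac.intervalIntegrable_deriv.congr_ae h.deriv_ae_eq

lemma integral_eq_sub (h : IsPrimitiveOn u u' a b) : ∫ s in a..b, u' s = u b - u a := by
  rw [← h.ac.integral_deriv_eq_sub]
  exact (intervalIntegral.integral_congr_ae_restrict h.deriv_ae_eq).symm

lemma eq_left_of_deriv_eq_zero (h : IsPrimitiveOn u u' a b) (h0 : ∀ s ∈ uIcc a b, u' s = 0) :
    ∀ s ∈ uIcc a b, u s = u a := by
  obtain ⟨C, hC⟩ := (h.congr_deriv h0).ac.const_of_ae_hasDerivAt_zero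
    (h.congr_deriv h0).hasDerivAt
  exact fun s hs => (hC s hs).trans (hC a left_mem_uIcc).symm

lemma of_integral {u₀ : ℝ} (hab : a ≤ b) (hi : IntervalIntegrable u' volume a b)
    (hu : ∀ s ∈ Icc a b, u s = u₀ + ∫ r in a..s, u' r) : IsPrimitiveOn u u' a b := by
  have hI : AbsolutelyContinuousOnInterval (fun s => u₀ + ∫ r in a..s, u' r) a b :=
    (const u₀ a b).ac.add (hi.absolutelyContinuousOnInterval_intervalIntegral left_mem_uIcc)
  refine ⟨?_, ?_⟩
  · rw [absolutelyContinuousOnInterval_iff] at hI ⊢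
    intro ε hε
    obtain ⟨δ, hδ, H⟩ := hI ε hε
    refine ⟨δ, hδ, fun E hE hl => ?_⟩
    convert H E hE hl using 1
    refine Finset.sum_congr rfl fun i hi => ?_
    have := hE.1 i hi
    rw [uIcc_of_le hab] at this
    rw [hu _ this.1, hu _ this.2]
  -- The formula for `u` is known on `[a, b]` only, so it determines the two-sided derivative only
  -- at interior points; the endpoints are a null set.
  · have ha : ∀ᵐ s : ℝ, s ≠ a := by simp [ae_iff, measure_singleton]
    have hb : ∀ᵐ s : ℝ, s ≠ b := by simp [ae_iff, measure_singleton]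
    filter_upwards [hi.ae_hasDerivAt_integral, ha, hb] with s hs hsa hsb hm
    have h1 := (hs hm a left_mem_uIcc).const_add u₀
    rw [uIcc_of_le hab] at hm
    refine h1.congr_of_eventuallyEq ?_
    filter_upwards [Icc_mem_nhds (lt_of_le_of_ne hm.1 hsa.symm) (lt_of_le_of_ne hm.2 hsb)]
      with r hr using hu r hr

/-- A quantitative form of strict monotonicity. -/
lemma sub_le_of_deriv_le (h : IsPrimitiveOn u u' a b) (hab : a ≤ b) {k : ℝ}
    (hk : ∀ᵐ s, s ∈ Icc a b → u' s ≤ k) : u b - u a ≤ k * (b - a) := by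
  rw [← h.integral_eq_sub]
  have : ∫ s in a..b, u' s ≤ ∫ _ in a..b, k := by
    refine intervalIntegral.integral_mono_ae_restrict hab h.intervalIntegrable
      intervalIntegrable_const ?_
    exact (ae_restrict_iff' measurableSet_Icc).2 hk
  simpa [mul_comm] using this

end IsPrimitiveOn

/-- The coordinates of `u` are absolutely continuous, with derivative `u'` almost everywhere. -/
def IsVecPrimitiveOn (u u' : ℝ → E3) (a b : ℝ) : Prop :=
  ∀ i, IsPrimitiveOn (fun s => u s i) (fun s => u' s i) a b

lemma inner_eq_sum (a b : E3) : inner ℝ a b = a 0 * b 0 + a 1 * b 1 + a 2 * b 2 := by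
  simp [PiLp.inner_apply, Fin.sum_univ_three, mul_comm]

@[simp] lemma vecCross_zero (a b : E3) : vecCross a b 0 = a 1 * b 2 - a 2 * b 1 := by
  simp [vecCross, cross_apply]
@[simp] lemma vecCross_one (a b : E3) : vecCross a b 1 = a 2 * b 0 - a 0 * b 2 := by
  simp [vecCross, cross_apply]
@[simp] lemma vecCross_two (a b : E3) : vecCross a b 2 = a 0 * b 1 - a 1 * b 0 := by
  simp [vecCross, cross_apply]

lemma continuousOn_vecCross {S : Set ℝ} {u v : ℝ → E3} (hu : ContinuousOn u S)
    (hv : ContinuousOn v S) : ContinuousOn (fun s => vecCross (u s) (v s)) S := by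
  have hc : ∀ {f : ℝ → E3}, ContinuousOn f S → ∀ i, ContinuousOn (fun s => f s i) S :=
    fun hf i => (EuclideanSpace.proj (𝕜 := ℝ) i).continuous.comp_continuousOn hf
  refine (PiLp.continuous_toLp 2 _).comp_continuousOn (continuousOn_pi.2 fun i => ?_)
  simp only [cross_apply]
  have hu' := hc hu
  have hv' := hc hv
  fin_cases i
  · exact ((hu' 1).mul (hv' 2)).sub ((hu' 2).mul (hv' 1))
  · exact ((hu' 2).mul (hv' 0)).sub ((hu' 0).mul (hv' 2))
  · exact ((hu' 0).mul (hv' 1)).sub ((hu' 1).mul (hv' 0))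

namespace IsVecPrimitiveOn

variable {u v u' v' w' : ℝ → E3} {a b : ℝ}

lemma congr_deriv (h : IsVecPrimitiveOn u u' a b) (e : ∀ s ∈ uIcc a b, u' s = w' s) :
    IsVecPrimitiveOn u w' a b :=
  fun i => (h i).congr_deriv fun s hs => by rw [e s hs]

lemma sub (hu : IsVecPrimitiveOn u u' a b) (hv : IsVecPrimitiveOn v v' a b) :
    IsVecPrimitiveOn (fun s => u s - v s) (fun s => u' s - v' s) a b :=
  fun i => (hu i).sub (hv i)

lemma const (k : E3) (a b : ℝ) : IsVecPrimitiveOn (fun _ => k) (fun _ => 0) a b :=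
  fun i => IsPrimitiveOn.const (k i) a b

lemma inner (hu : IsVecPrimitiveOn u u' a b) (hv : IsVecPrimitiveOn v v' a b) :
    IsPrimitiveOn (fun s => inner ℝ (u s) (v s))
      (fun s => inner ℝ (u' s) (v s) + inner ℝ (u s) (v' s)) a b := by
  simp only [inner_eq_sum]
  exact ((((hu 0).mul (hv 0)).add ((hu 1).mul (hv 1))).add ((hu 2).mul (hv 2))).congr_deriv
    fun s _ => by ring

lemma cross (hu : IsVecPrimitiveOn u u' a b) (hv : IsVecPrimitiveOn v v' a b) :
    IsVecPrimitiveOn (fun s => vecCross (u s) (v s))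
      (fun s => vecCross (u' s) (v s) + vecCross (u s) (v' s)) a b := by
  intro i
  fin_cases i
  · exact ((((hu 1).mul (hv 2)).sub ((hu 2).mul (hv 1))).congr_deriv fun s _ => by
      simp; ring).congr_fun fun s => by simp
  · exact ((((hu 2).mul (hv 0)).sub ((hu 0).mul (hv 2))).congr_deriv fun s _ => by
      simp; ring).congr_fun fun s => by simp
  · exact ((((hu 0).mul (hv 1)).sub ((hu 1).mul (hv 0))).congr_deriv fun s _ => by
      simp; ring).congr_fun fun s => by simp

lemma of_integral {u₀ : E3} (hab : a ≤ b) (hi : IntervalIntegrable u' volume a b)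
    (hu : ∀ s ∈ Icc a b, u s = u₀ + ∫ r in a..s, u' r) : IsVecPrimitiveOn u u' a b := by
  intro i
  have hint : IntervalIntegrable (fun s => u' s i) volume a b :=
    ⟨(EuclideanSpace.proj (𝕜 := ℝ) i).integrable_comp hi.1,
      (EuclideanSpace.proj (𝕜 := ℝ) i).integrable_comp hi.2⟩
  refine .of_integral (u₀ := u₀ i) hab hint fun s hs => ?_
  have hs' : IntervalIntegrable u' volume a s :=
    hi.mono_set (by rw [uIcc_of_le hab, uIcc_of_le hs.1]; exact Icc_subset_Icc_right hs.2)
  have : ∫ r in a..s, u' r i = (∫ r in a..s, u' r) i :=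
    (EuclideanSpace.proj (𝕜 := ℝ) i).intervalIntegral_comp_comm hs'
  simp [hu s hs, this]

end IsVecPrimitiveOn

/-! ### Orthonormal frames and solvability of the Cauchy problem -/

/-- An absolutely continuous orthonormal frame `(t, d, n)` with `n = t × d` along a midline `x`,
moving with the densities `κ`. -/
structure IsRodFrame (L : ℝ) (κ x t d n : ℝ → E3) : Prop where
  prim_x : IsVecPrimitiveOn x t 0 L
  prim_t : IsVecPrimitiveOn t (fun s => κ s 1 • d s - κ s 0 • n s) 0 L
  prim_d : IsVecPrimitiveOn d (fun s => κ s 2 • n s - κ s 1 • t s) 0 L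
  prim_n : IsVecPrimitiveOn n (fun s => κ s 0 • t s - κ s 2 • d s) 0 L
  n_eq : ∀ s, n s = vecCross (t s) (d s)
  tt : ∀ s ∈ Icc 0 L, inner ℝ (t s) (t s) = 1
  dd : ∀ s ∈ Icc 0 L, inner ℝ (d s) (d s) = 1
  td : ∀ s ∈ Icc 0 L, inner ℝ (t s) (d s) = 0

lemma intervalIntegrable_coord_smul {L : ℝ} (hL : 0 ≤ L) {κ : ℝ → E3}
    (hκ : IntegrableOn κ (Icc 0 L)) (i : Fin 3) {u : ℝ → E3} (hu : ContinuousOn u (Icc 0 L)) :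
    IntervalIntegrable (fun s => κ s i • u s) volume 0 L := by
  rw [intervalIntegrable_iff_integrableOn_Icc_of_le hL]
  have h1 : IntegrableOn (fun s => κ s i) (Icc 0 L) :=
    (EuclideanSpace.proj (𝕜 := ℝ) i).integrable_comp hκ
  exact h1.smul_continuousOn hu isCompact_Icc

lemma inner_vecCross_left (a b : E3) : inner ℝ a (vecCross a b) = 0 := by
  simp [inner_eq_sum]; ring

lemma inner_vecCross_right (a b : E3) : inner ℝ b (vecCross a b) = 0 := by
  simp [inner_eq_sum]; ring

lemma inner_vecCross_self (a b : E3) : inner ℝ (vecCross a b) (vecCross a b) =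
    inner ℝ a a * inner ℝ b b - inner ℝ a b ^ 2 := by
  simp only [inner_eq_sum, vecCross_zero, vecCross_one, vecCross_two]; ring

lemma vecCross_vecCross_self_right (a b : E3) :
    vecCross (vecCross a b) b = inner ℝ a b • b - inner ℝ b b • a := by
  rw [inner_eq_sum, inner_eq_sum]
  ext i; fin_cases i <;> simp <;> ring

lemma vecCross_self_vecCross (a b : E3) :
    vecCross a (vecCross a b) = inner ℝ a b • a - inner ℝ a a • b := by
  rw [inner_eq_sum, inner_eq_sum]
  ext i; fin_cases i <;> simp <;> ring

/-- Orthonormality propagates from `s = 0` through conserved quantities. With `a = |t|²`, `b =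
|d|²`, `p = t · d` the equations give `a' = 2κ₂p`, `b' = -2κ₂p`, `p' = κ₂(b - a)`, so `a + b` and
`(a - b)² + 4p²` are constant. The equation for `t × d` then follows from `(t × d) × d = -t` and `t
× (t × d) = -d`. -/
theorem IsRodSolution.isRodFrame {L : ℝ} (hL : 0 ≤ L) {κ : ℝ → E3}
    (hκ : IntegrableOn κ (Icc 0 L)) {x₀ t₀ d₀ : E3} {x t d : ℝ → E3}
    (h : IsRodSolution L κ x₀ t₀ d₀ x t d) (ht : ‖t₀‖ = 1) (hd : ‖d₀‖ = 1)
    (htd : inner ℝ t₀ d₀ = 0) :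
    IsRodFrame L κ x t d (fun s => vecCross (t s) (d s)) := by
  have hI : uIcc 0 L = Icc 0 L := uIcc_of_le hL
  have hn := continuousOn_vecCross h.continuousOn_t h.continuousOn_d
  have px : IsVecPrimitiveOn x t 0 L :=
    .of_integral hL ((h.continuousOn_t.mono hI.le).intervalIntegrable) h.eq_x
  have pt := IsVecPrimitiveOn.of_integral hL
    ((intervalIntegrable_coord_smul hL hκ 1 h.continuousOn_d).sub
      (intervalIntegrable_coord_smul hL hκ 0 hn)) h.eq_t
  have pd := IsVecPrimitiveOn.of_integral hL
    ((intervalIntegrable_coord_smul hL hκ 2 hn).sub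
      (intervalIntegrable_coord_smul hL hκ 1 h.continuousOn_t)) h.eq_d
  have z : (0 : ℝ) ∈ Icc 0 L := ⟨le_rfl, hL⟩
  have e1 : t 0 = t₀ := by simpa using h.eq_t 0 z
  have e2 : d 0 = d₀ := by simpa using h.eq_d 0 z
  have patt := (pt.inner pt).congr_deriv (w' := fun s => 2 * κ s 1 * inner ℝ (t s) (d s))
    fun s _ => by
      simp only [inner_sub_right, inner_smul_right, inner_vecCross_left, real_inner_comm (t s)]
      ring
  have padd := (pd.inner pd).congr_deriv (w' := fun s => -(2 * κ s 1 * inner ℝ (t s) (d s)))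
    fun s _ => by
      simp only [inner_sub_right, inner_smul_right, inner_vecCross_right, real_inner_comm (d s)]
      ring
  have patd := (pt.inner pd).congr_deriv
    (w' := fun s => κ s 1 * (inner ℝ (d s) (d s) - inner ℝ (t s) (t s)))
    fun s _ => by
      simp only [inner_sub_left, inner_sub_right, inner_smul_left, inner_smul_right,
        inner_vecCross_right, inner_vecCross_left, real_inner_comm _ (vecCross (t s) (d s)),
        RCLike.conj_to_real]
      ring
  have hsum := (patt.add padd).eq_left_of_deriv_eq_zero (fun s _ => by ring)
  have hsq := (((patt.sub padd).pow_two).add ((IsPrimitiveOn.const 4 0 L).mul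
    patd.pow_two)).eq_left_of_deriv_eq_zero (fun s _ => by ring)
  simp only [e1, e2, htd, real_inner_self_eq_norm_sq t₀, real_inner_self_eq_norm_sq d₀, ht, hd,
    hI] at hsum hsq
  have horth : ∀ s ∈ Icc 0 L, inner ℝ (t s) (t s) = 1 ∧ inner ℝ (d s) (d s) = 1 ∧
      inner ℝ (t s) (d s) = 0 := fun s hs => by
    have h1 := hsum s hs
    have h2 := hsq s hs
    have h3 : inner ℝ (t s) (d s) = 0 := by
      apply pow_eq_zero_iff (two_ne_zero) |>.1
      nlinarith [sq_nonneg (inner ℝ (t s) (t s) - inner ℝ (d s) (d s)),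
        sq_nonneg (inner ℝ (t s) (d s))]
    have h4 : inner ℝ (t s) (t s) - inner ℝ (d s) (d s) = 0 := by
      apply pow_eq_zero_iff (two_ne_zero) |>.1
      rw [h3] at h2
      linarith
    exact ⟨by linarith, by linarith, h3⟩
  refine ⟨px, pt, pd, ?_, fun _ => rfl, fun s hs => (horth s hs).1, fun s hs => (horth s hs).2.1,
    fun s hs => (horth s hs).2.2⟩
  refine (pt.cross pd).congr_deriv fun s hs => ?_
  obtain ⟨h1, h2, h3⟩ := horth s (hI ▸ hs)
  have h4 := vecCross_vecCross_self_right (t s) (d s)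
  have h5 := vecCross_self_vecCross (t s) (d s)
  rw [h3, h2, zero_smul, one_smul, zero_sub] at h4
  rw [h3, h1, zero_smul, one_smul, zero_sub] at h5
  have h40 := congr($h4 0)
  have h41 := congr($h4 1)
  have h42 := congr($h4 2)
  have h50 := congr($h5 0)
  have h51 := congr($h5 1)
  have h52 := congr($h5 2)
  ext i
  fin_cases i <;> simp at h40 h41 h42 h50 h51 h52 ⊢
  · linear_combination (-κ s 0) * h40 + κ s 2 * h50
  · linear_combination (-κ s 0) * h41 + κ s 2 * h51
  · linear_combination (-κ s 0) * h42 + κ s 2 * h52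

/-- The system is quadratic because of `t × d`. Treating this product as a third unknown `n` with
`n' = κ₁ t - ω d` makes the system linear, and `n = t × d` is recovered afterwards. -/
theorem exists_isRodSolution {L : ℝ} (hL : 0 ≤ L) {κ : ℝ → E3}
    (hκ : IntegrableOn κ (Icc 0 L)) (x₀ : E3) {t₀ d₀ : E3} (ht : ‖t₀‖ = 1) (hd : ‖d₀‖ = 1)
    (htd : inner ℝ t₀ d₀ = 0) : ∃ x t d, IsRodSolution L κ x₀ t₀ d₀ x t d := by
  let T : E3 × E3 × E3 →L[ℝ] E3 := .fst ℝ _ _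
  let D : E3 × E3 × E3 →L[ℝ] E3 := (ContinuousLinearMap.fst ℝ _ _).comp (.snd ℝ _ _)
  let N : E3 × E3 × E3 →L[ℝ] E3 := (ContinuousLinearMap.snd ℝ _ _).comp (.snd ℝ _ _)
  -- Extension by zero gives a kernel integrable on the whole line, as the Volterra theorem
  -- requires.
  let κ' := (Icc 0 L).indicator κ
  have hκ' : Integrable κ' := hκ.integrable_indicator measurableSet_Icc
  have hi : ∀ i, Integrable (fun s => κ' s i) := fun i =>
    (EuclideanSpace.proj (𝕜 := ℝ) i).integrable_comp hκ'
  let A₀ := (-N).prod ((0 : E3 × E3 × E3 →L[ℝ] E3).prod T)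
  let A₁ := D.prod ((-T).prod (0 : E3 × E3 × E3 →L[ℝ] E3))
  let A₂ := (0 : E3 × E3 × E3 →L[ℝ] E3).prod (N.prod (-D))
  let A : ℝ → (E3 × E3 × E3) →L[ℝ] (E3 × E3 × E3) := fun s =>
    κ' s 0 • A₀ + κ' s 1 • A₁ + κ' s 2 • A₂
  have hA : Integrable A :=
    (((hi 0).smul_const A₀).add ((hi 1).smul_const A₁)).add ((hi 2).smul_const A₂)
  obtain ⟨u, huc, hu⟩ := exists_continuous_eq_add_integral hA hL (t₀, d₀, vecCross t₀ d₀)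
  have hAu : IntervalIntegrable (fun r => A r (u r)) volume 0 L :=
    intervalIntegrable_clm_apply hA huc 0 L
  have hI : uIcc 0 L = Icc 0 L := uIcc_of_le hL
  have key : ∀ (P : E3 × E3 × E3 →L[ℝ] E3) (w' : ℝ → E3),
      (∀ s ∈ Icc 0 L, P (A s (u s)) = w' s) →
      ∀ s ∈ Icc 0 L, P (u s) = P (t₀, d₀, vecCross t₀ d₀) + ∫ r in (0 : ℝ)..s, w' r := by
    intro P w' hw s hs
    have hsub : uIcc 0 s ⊆ uIcc 0 L := by
      rw [hI, uIcc_of_le hs.1]; exact Icc_subset_Icc_right hs.2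
    rw [hu s hs, map_add, ← P.intervalIntegral_comp_comm (hAu.mono_set hsub)]
    congr 1
    exact intervalIntegral.integral_congr fun r hr => hw r (hI ▸ hsub hr)
  have hint : ∀ (P : E3 × E3 × E3 →L[ℝ] E3) (w' : ℝ → E3),
      (∀ s ∈ Icc 0 L, P (A s (u s)) = w' s) → IntervalIntegrable w' volume 0 L := by
    intro P w' hw
    have : IntervalIntegrable (fun s => P (A s (u s))) volume 0 L :=
      ⟨P.integrable_comp hAu.1, P.integrable_comp hAu.2⟩
    exact this.congr fun s hs => hw s (hI ▸ uIoc_subset_uIcc hs)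
  have hκκ : ∀ s ∈ Icc 0 L, κ' s = κ s := fun s hs => indicator_of_mem hs κ
  let t := fun s => (u s).1
  let d := fun s => (u s).2.1
  let n := fun s => (u s).2.2
  have wt : ∀ s ∈ Icc 0 L, T (A s (u s)) = κ s 1 • d s - κ s 0 • n s := fun s hs => by
    simp [A, A₀, A₁, A₂, T, D, N, hκκ s hs, d, n]; abel
  have wd : ∀ s ∈ Icc 0 L, D (A s (u s)) = κ s 2 • n s - κ s 1 • t s := fun s hs => by
    simp [A, A₀, A₁, A₂, T, D, N, hκκ s hs, t, n]; abel
  have wn : ∀ s ∈ Icc 0 L, N (A s (u s)) = κ s 0 • t s - κ s 2 • d s := fun s hs => by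
    simp [A, A₀, A₁, A₂, T, D, N, hκκ s hs, t, d]; abel
  have pt : IsVecPrimitiveOn t _ 0 L := .of_integral hL (hint T _ wt) (key T _ wt)
  have pd : IsVecPrimitiveOn d _ 0 L := .of_integral hL (hint D _ wd) (key D _ wd)
  have pn : IsVecPrimitiveOn n _ 0 L := .of_integral hL (hint N _ wn) (key N _ wn)
  have z : (0 : ℝ) ∈ Icc 0 L := ⟨le_rfl, hL⟩
  have et : t 0 = t₀ := by simpa [T] using key T _ wt 0 z
  have ed : d 0 = d₀ := by simpa [D] using key D _ wd 0 z
  have en : n 0 = vecCross t₀ d₀ := by simpa [N] using key N _ wn 0 z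
  -- The linear system is skew in `(t, d, n)`, so the determinant `n · (t × d)` is constant, and so
  -- is the squared Frobenius distance of the Gram matrix from the identity (`hgram`).
  have hdet := (pn.inner (pt.cross pd)).eq_left_of_deriv_eq_zero fun s _ => by
    simp [inner_eq_sum]; ring
  have one := IsPrimitiveOn.const 1 0 L
  have two := IsPrimitiveOn.const 2 0 L
  have hgram := (((((pt.inner pt).sub one).pow_two.add ((pd.inner pd).sub one).pow_two).add
    ((pn.inner pn).sub one).pow_two).add (two.mul (((pt.inner pd).pow_two.add
      (pt.inner pn).pow_two).add (pd.inner pn).pow_two))).eq_left_of_deriv_eq_zero fun s _ => by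
    simp only [inner_sub_left, inner_sub_right, inner_smul_left, inner_smul_right,
      real_inner_comm (t s) (d s), real_inner_comm (t s) (n s), real_inner_comm (d s) (n s),
      RCLike.conj_to_real]
    ring
  simp only [et, ed, en, htd, real_inner_self_eq_norm_sq t₀, real_inner_self_eq_norm_sq d₀, ht, hd,
    inner_vecCross_left, inner_vecCross_right, inner_vecCross_self, hI] at hdet hgram
  have hn : ∀ s ∈ Icc 0 L, n s = vecCross (t s) (d s) := fun s hs => by
    have h1 := hdet s hs
    have h2 := hgram s hs
    have h3 := inner_vecCross_self (t s) (d s)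
    set a := inner ℝ (t s) (t s)
    set b := inner ℝ (d s) (d s)
    set c := inner ℝ (n s) (n s) with hc
    set p := inner ℝ (t s) (d s)
    have s1 := sq_nonneg (a - 1)
    have s2 := sq_nonneg (b - 1)
    have s3 := sq_nonneg (c - 1)
    have s4 := sq_nonneg p
    have s5 := sq_nonneg (inner ℝ (t s) (n s))
    have s6 := sq_nonneg (inner ℝ (d s) (n s))
    have ha : a - 1 = 0 :=
      pow_eq_zero_iff two_ne_zero |>.1 (by linarith)
    have hb : b - 1 = 0 :=
      pow_eq_zero_iff two_ne_zero |>.1 (by linarith)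
    have hc' : c - 1 = 0 :=
      pow_eq_zero_iff two_ne_zero |>.1 (by linarith)
    have hp : p = 0 :=
      pow_eq_zero_iff two_ne_zero |>.1 (by linarith)
    rw [sub_eq_zero] at ha hb hc'
    rw [ha, hb, hp] at h3
    -- `|n - t × d|² = 1 - 2 + 1 = 0`.
    rw [← sub_eq_zero, ← inner_self_eq_zero (𝕜 := ℝ), inner_sub_sub_self,
      real_inner_comm (n s) (vecCross _ _), ← hc, hc', h1, h3]
    norm_num
  refine ⟨fun s => x₀ + ∫ r in (0 : ℝ)..s, t r, t, d, ?_, ?_, ?_, fun _ _ => rfl, ?_, ?_⟩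
  · have : Continuous t := huc.fst
    exact (continuous_const.add (intervalIntegral.continuous_primitive
      (fun a b => this.intervalIntegrable a b) 0)).continuousOn
  · exact huc.fst.continuousOn
  · exact huc.snd.fst.continuousOn
  · exact key T _ fun s hs => by rw [wt s hs, hn s hs]
  · exact key D _ fun s hs => by rw [wd s hs, hn s hs]

/-- The remainder `w` is orthogonal to `t`, `d` and `n`. Lagrange's identity `|w|² |n|² = (n · w)² +
|w × n|²`, with `w × n` expanded in `t` and `d`, then gives `w = 0`. -/
lemma eq_frame_sum {t d v : E3} (htt : inner ℝ t t = 1) (hdd : inner ℝ d d = 1)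
    (htd : inner ℝ t d = 0) (hv : inner ℝ t v = 0) :
    v = inner ℝ d v • d + inner ℝ (vecCross t d) v • vecCross t d := by
  set n := vecCross t d with hn
  set w := v - (inner ℝ d v • d + inner ℝ n v • n) with hw
  have hnn : inner ℝ n n = 1 := by rw [hn, inner_vecCross_self, htt, hdd, htd]; norm_num
  have htn : inner ℝ t n = 0 := inner_vecCross_left t d
  have hdn : inner ℝ d n = 0 := inner_vecCross_right t d
  have h1 : inner ℝ t w = 0 := by
    simp only [hw, inner_sub_right, inner_add_right, inner_smul_right, hv, htd, htn]; ring
  have h2 : inner ℝ d w = 0 := by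
    simp only [hw, inner_sub_right, inner_add_right, inner_smul_right, hdd, hdn]; ring
  have h3 : inner ℝ n w = 0 := by
    simp only [hw, inner_sub_right, inner_add_right, inner_smul_right, hnn,
      real_inner_comm d n, hdn]; ring
  have h4 : inner ℝ w w * inner ℝ n n = inner ℝ n w ^ 2 +
      inner ℝ (inner ℝ d w • t - inner ℝ t w • d) (inner ℝ d w • t - inner ℝ t w • d) := by
    simp only [hn, inner_eq_sum, vecCross_zero, vecCross_one, vecCross_two, PiLp.sub_apply,
      PiLp.smul_apply, smul_eq_mul]
    ring
  rw [h1, h2, h3, hnn] at h4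
  have : w = 0 := by
    rw [← inner_self_eq_zero (𝕜 := ℝ)]; simpa using h4
  exact sub_eq_zero.1 this

/-! ### Height over the moving cross-section: local injectivity and openness -/

/-- A linear form bounded by `1` on a box stays quantitatively below `1` on a smaller one. -/
lemma div_add_le_one_sub {K r a b ζ₁ ζ₂ : ℝ} (hr : 0 < r) (hK₁ : |ζ₁| ≤ K) (hK₂ : |ζ₂| ≤ K)
    (h : ∀ ε₁ ε₂ : ℝ, |ε₁| ≤ r → |ε₂| ≤ r → (ζ₁ + ε₁) * a - (ζ₂ + ε₂) * b ≤ 1) :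
    r / (K + r) ≤ 1 - (ζ₁ * a - ζ₂ * b) := by
  have hK : 0 ≤ K := (abs_nonneg _).trans hK₁
  have hr1 : |r| ≤ r := (abs_of_pos hr).le
  have hr2 : |-r| ≤ r := by rw [abs_neg]; exact hr1
  -- The perturbation is taken at the corner of the box where the form gains most; the four corners
  -- cover all signs of `a` and `b`.
  have h1 : r * (|a| + |b|) ≤ 1 - (ζ₁ * a - ζ₂ * b) := by
    have e1 := h r r hr1 hr1
    have e2 := h r (-r) hr1 hr2
    have e3 := h (-r) r hr2 hr1
    have e4 := h (-r) (-r) hr2 hr2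
    rcases abs_cases a with ⟨ha, -⟩ | ⟨ha, -⟩ <;> rcases abs_cases b with ⟨hb, -⟩ | ⟨hb, -⟩ <;>
      rw [ha, hb] <;> linarith
  have h2 : ζ₁ * a - ζ₂ * b ≤ K * (|a| + |b|) := by
    have e1 : ζ₁ * a ≤ K * |a| :=
      (le_abs_self _).trans (by rw [abs_mul]; gcongr)
    have e2 : -(ζ₂ * b) ≤ K * |b| :=
      (neg_le_abs _).trans (by rw [abs_mul]; gcongr)
    linarith
  -- With `ℓ = ζ₁ a - ζ₂ b`: `K(1 - ℓ) ≥ K r (|a| + |b|) ≥ r ℓ`, hence `(K + r)(1 - ℓ) ≥ r`. The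
  -- size of `a` and `b` has dropped out, which is what unbounded curvatures require.
  rw [div_le_iff₀ (by positivity)]
  nlinarith [mul_le_mul_of_nonneg_left h1 hK, mul_le_mul_of_nonneg_left h2 hr.le]

/-- The configuration of a rod with midline `x` and cross-sectional directors `d`, `n`. -/
def frameConfig (x d n : ℝ → E3) (q : ℝ × ℝ × ℝ) : E3 :=
  x q.1 + q.2.1 • d q.1 + q.2.2 • n q.1

/-- The set of points whose first coordinate lies in `[0, L]`, over given cross-sections. -/
def tube (L : ℝ) (A : ℝ → Set (ℝ × ℝ)) : Set (ℝ × ℝ × ℝ) := {q | q.1 ∈ Icc 0 L ∧ q.2 ∈ A q.1}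

namespace IsVecPrimitiveOn

variable {u u' : ℝ → E3} {a b : ℝ}

lemma continuousOn (h : IsVecPrimitiveOn u u' a b) : ContinuousOn u (uIcc a b) := by
  have : ContinuousOn (fun s => WithLp.toLp 2 fun i => u s i) (uIcc a b) :=
    (PiLp.continuous_toLp 2 _).comp_continuousOn (continuousOn_pi.2 fun i => (h i).ac.continuousOn)
  exact this

end IsVecPrimitiveOn

namespace IsRodFrame

variable {L : ℝ} {κ x t d n : ℝ → E3}

lemma continuousOn_x (h : IsRodFrame L κ x t d n) (hL : 0 ≤ L) : ContinuousOn x (Icc 0 L) :=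
  uIcc_of_le hL ▸ h.prim_x.continuousOn
lemma continuousOn_t (h : IsRodFrame L κ x t d n) (hL : 0 ≤ L) : ContinuousOn t (Icc 0 L) :=
  uIcc_of_le hL ▸ h.prim_t.continuousOn
lemma continuousOn_d (h : IsRodFrame L κ x t d n) (hL : 0 ≤ L) : ContinuousOn d (Icc 0 L) :=
  uIcc_of_le hL ▸ h.prim_d.continuousOn
lemma continuousOn_n (h : IsRodFrame L κ x t d n) (hL : 0 ≤ L) : ContinuousOn n (Icc 0 L) :=
  uIcc_of_le hL ▸ h.prim_n.continuousOn

lemma tn (h : IsRodFrame L κ x t d n) (s : ℝ) : inner ℝ (t s) (n s) = 0 := by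
  rw [h.n_eq, inner_vecCross_left]

lemma dn (h : IsRodFrame L κ x t d n) (s : ℝ) : inner ℝ (d s) (n s) = 0 := by
  rw [h.n_eq, inner_vecCross_right]

lemma nn (h : IsRodFrame L κ x t d n) {s : ℝ} (hs : s ∈ Icc 0 L) : inner ℝ (n s) (n s) = 1 := by
  rw [h.n_eq, inner_vecCross_self, h.tt s hs, h.dd s hs, h.td s hs]; norm_num

/-- Since `t · t = 1` and `t' = κ₂ d - κ₁ n`, the height of a fixed point changes at minus the
Jacobian, evaluated at the coordinates of that point in the plane at `s`. -/
lemma prim_height (h : IsRodFrame L κ x t d n) (hL : 0 ≤ L) (y : E3) :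
    IsPrimitiveOn (fun s => inner ℝ (t s) (y - x s))
      (fun s => inner ℝ (d s) (y - x s) * κ s 1 - inner ℝ (n s) (y - x s) * κ s 0 - 1) 0 L := by
  refine (h.prim_t.inner ((IsVecPrimitiveOn.const y 0 L).sub h.prim_x)).congr_deriv fun s hs => ?_
  rw [uIcc_of_le hL] at hs
  rw [zero_sub, inner_neg_right, h.tt s hs, inner_sub_left, inner_smul_left, inner_smul_left]
  simp only [RCLike.conj_to_real]
  ring

lemma inner_config (h : IsRodFrame L κ x t d n) {q : ℝ × ℝ × ℝ} (hq : q.1 ∈ Icc 0 L) :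
    inner ℝ (t q.1) (frameConfig x d n q - x q.1) = 0 ∧
    inner ℝ (d q.1) (frameConfig x d n q - x q.1) = q.2.1 ∧
    inner ℝ (n q.1) (frameConfig x d n q - x q.1) = q.2.2 := by
  have e : frameConfig x d n q - x q.1 = q.2.1 • d q.1 + q.2.2 • n q.1 := by
    rw [frameConfig]; abel
  simp only [e, inner_add_right, inner_smul_right, h.td _ hq, h.tn, h.dd _ hq, h.dn, h.nn hq,
    real_inner_comm (d q.1) (n q.1)]
  simp

lemma config_eq (h : IsRodFrame L κ x t d n) {s : ℝ} (hs : s ∈ Icc 0 L) {y : E3}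
    (hy : inner ℝ (t s) (y - x s) = 0) :
    frameConfig x d n (s, inner ℝ (d s) (y - x s), inner ℝ (n s) (y - x s)) = y := by
  have := eq_frame_sum (h.tt s hs) (h.dd s hs) (h.td s hs) hy
  rw [← h.n_eq] at this
  rw [frameConfig, add_assoc, ← this]
  abel

lemma continuousOn_config (h : IsRodFrame L κ x t d n) (hL : 0 ≤ L) (A : ℝ → Set (ℝ × ℝ)) :
    ContinuousOn (frameConfig x d n) (tube L A) := by
  have hm : MapsTo Prod.fst (tube L A) (Icc 0 L) := fun q hq => hq.1
  have hf : ContinuousOn (Prod.fst : ℝ × ℝ × ℝ → ℝ) (tube L A) := continuousOn_fst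
  have h1 : ContinuousOn (fun q : ℝ × ℝ × ℝ => x q.1) (tube L A) := (h.continuousOn_x hL).comp hf hm
  have h2 : ContinuousOn (fun q : ℝ × ℝ × ℝ => d q.1) (tube L A) := (h.continuousOn_d hL).comp hf hm
  have h3 : ContinuousOn (fun q : ℝ × ℝ × ℝ => n q.1) (tube L A) := (h.continuousOn_n hL).comp hf hm
  have g1 : ContinuousOn (fun q : ℝ × ℝ × ℝ => q.2.1) (tube L A) := by fun_prop
  have g2 : ContinuousOn (fun q : ℝ × ℝ × ℝ => q.2.2) (tube L A) := by fun_prop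
  exact (h1.add (g1.smul h2)).add (g2.smul h3)

lemma tendsto_coord {s₀ : ℝ} {y₀ : E3} {u : ℝ → E3} (hs : Icc 0 L ∈ 𝓝 s₀)
    (hu : ContinuousOn u (Icc 0 L)) (hx : ContinuousOn x (Icc 0 L)) :
    Tendsto (fun p : ℝ × E3 => inner ℝ (u p.1) (p.2 - x p.1)) (𝓝 s₀ ×ˢ 𝓝 y₀)
      (𝓝 (inner ℝ (u s₀) (y₀ - x s₀))) := by
  have h1 : Tendsto (fun p : ℝ × E3 => u p.1) (𝓝 s₀ ×ˢ 𝓝 y₀) (𝓝 (u s₀)) :=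
    (hu.continuousAt hs).tendsto.comp tendsto_fst
  have h2 : Tendsto (fun p : ℝ × E3 => x p.1) (𝓝 s₀ ×ˢ 𝓝 y₀) (𝓝 (x s₀)) :=
    (hx.continuousAt hs).tendsto.comp tendsto_fst
  exact h1.inner (tendsto_snd.sub h2)

/-- Near an interior point, the material coordinates depend continuously on time and position. -/
lemma exists_coords_near (h : IsRodFrame L κ x t d n) (hL : 0 ≤ L) {q₀ : ℝ × ℝ × ℝ}
    (hq : Icc 0 L ∈ 𝓝 q₀.1) {W : Set (ℝ × ℝ × ℝ)} (hW : W ∈ 𝓝 q₀) :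
    ∃ δ > 0, Icc (q₀.1 - δ) (q₀.1 + δ) ⊆ Icc 0 L ∧ ∀ᶠ y in 𝓝 (frameConfig x d n q₀),
      ∀ s ∈ Icc (q₀.1 - δ) (q₀.1 + δ),
        (s, inner ℝ (d s) (y - x s), inner ℝ (n s) (y - x s)) ∈ W := by
  obtain ⟨-, h2, h3⟩ := h.inner_config (mem_of_mem_nhds hq)
  have c1 := tendsto_coord (y₀ := frameConfig x d n q₀) hq (h.continuousOn_d hL)
    (h.continuousOn_x hL)
  have c2 := tendsto_coord (y₀ := frameConfig x d n q₀) hq (h.continuousOn_n hL)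
    (h.continuousOn_x hL)
  rw [h2] at c1
  rw [h3] at c2
  have c := (tendsto_fst (f := 𝓝 q₀.1) (g := 𝓝 (frameConfig x d n q₀))).prodMk_nhds
    (c1.prodMk_nhds c2)
  obtain ⟨pa, ha, pb, hb, hab⟩ := eventually_prod_iff.1 (c.eventually hW)
  obtain ⟨δ, hδ, hδs⟩ := Metric.nhds_basis_closedBall.mem_iff.1 (inter_mem ha hq)
  rw [Real.closedBall_eq_Icc] at hδs
  exact ⟨δ, hδ, fun s hs => (hδs hs).2, hb.mono fun y hy s hs => hab (hδs hs).1 hy⟩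

end IsRodFrame

lemma fst_mem_nhds_of_mem_interior_tube {L : ℝ} {A : ℝ → Set (ℝ × ℝ)} {q₀ : ℝ × ℝ × ℝ}
    (hq : q₀ ∈ interior (tube L A)) : Icc 0 L ∈ 𝓝 q₀.1 := by
  have h1 : Continuous fun s : ℝ => (s, q₀.2) := by fun_prop
  filter_upwards [h1.continuousAt.preimage_mem_nhds (mem_interior_iff_mem_nhds.1 hq)] with s hs
    using hs.1

namespace IsRodFrame

variable {L : ℝ} {κ x t d n : ℝ → E3} {A : ℝ → Set (ℝ × ℝ)}

/-- Near an interior point, the height over the moving cross-section strictly decreases. -/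
lemma exists_height_decreasing (h : IsRodFrame L κ x t d n) (hL : 0 ≤ L)
    (hN : ∀ᵐ s, s ∈ Icc 0 L → ∀ ζ ∈ A s, ζ.1 * κ s 1 - ζ.2 * κ s 0 ≤ 1)
    {q₀ : ℝ × ℝ × ℝ} (hq : q₀ ∈ interior (tube L A)) :
    ∃ δ > 0, ∃ c > 0, ∀ᶠ y in 𝓝 (frameConfig x d n q₀),
      ∀ a ∈ Icc (q₀.1 - δ) (q₀.1 + δ), ∀ b ∈ Icc (q₀.1 - δ) (q₀.1 + δ), a ≤ b →
        inner ℝ (t b) (y - x b) + c * (b - a) ≤ inner ℝ (t a) (y - x a) := by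
  obtain ⟨s₀, z₁, z₂⟩ := q₀
  obtain ⟨ρ, hρ, hball⟩ := Metric.nhds_basis_closedBall.mem_iff.1 (mem_interior_iff_mem_nhds.1 hq)
  have hbox : ∀ s ζ₁ ζ₂, |s - s₀| ≤ ρ → |ζ₁ - z₁| ≤ ρ → |ζ₂ - z₂| ≤ ρ → (ζ₁, ζ₂) ∈ A s :=
    fun s ζ₁ ζ₂ h1 h2 h3 => by
      have : (s, ζ₁, ζ₂) ∈ Metric.closedBall (s₀, z₁, z₂) ρ := by
        simp [Prod.dist_eq, Real.dist_eq, h1, h2, h3]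
      exact (hball this).2
  -- Half of the radius confines the coordinates of `y`; the other half remains as the margin `r`
  -- for perturbations inside `A s`.
  have hW : Metric.closedBall (s₀, z₁, z₂) (ρ / 2) ∈ 𝓝 (s₀, z₁, z₂) :=
    Metric.closedBall_mem_nhds _ (by positivity)
  obtain ⟨δ, hδ, hsub, hev⟩ := h.exists_coords_near hL (fst_mem_nhds_of_mem_interior_tube hq) hW
  set K := |z₁| + |z₂| + ρ with hKdef
  have hK : 0 ≤ K := by positivity
  refine ⟨δ, hδ, (ρ / 2) / (K + ρ / 2), by positivity, ?_⟩
  filter_upwards [hev] with y hy a ha b hb hab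
  have hIab : Icc a b ⊆ Icc (s₀ - δ) (s₀ + δ) := Icc_subset_Icc ha.1 hb.2
  have hp := (h.prim_height hL y).mono (c := a) (d := b) (by
    rw [uIcc_of_le hab, uIcc_of_le hL]; exact hIab.trans hsub)
  have := hp.sub_le_of_deriv_le (k := -((ρ / 2) / (K + ρ / 2))) hab (by
    -- The exceptional null set does not depend on `y`: for good `s` the constraint holds for all `ζ
    -- ∈ A s` at once, so the coordinates of `y` may vary with `s`.
    filter_upwards [hN] with s hs hm
    have hm' := hIab hm
    have hz := hy s hm'
    simp only [Metric.mem_closedBall, Prod.dist_eq, Real.dist_eq, max_le_iff] at hz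
    obtain ⟨hz0, hz1, hz2⟩ := hz
    have k1 := abs_le.1 hz1
    have k2 := abs_le.1 hz2
    have := div_add_le_one_sub (K := K) (r := ρ / 2) (a := κ s 1) (b := κ s 0) (by positivity)
      (ζ₁ := inner ℝ (d s) (y - x s)) (ζ₂ := inner ℝ (n s) (y - x s))
      (abs_le.2 ⟨by linarith [neg_abs_le z₁, abs_nonneg z₂], by
        linarith [le_abs_self z₁, abs_nonneg z₂]⟩)
      (abs_le.2 ⟨by linarith [neg_abs_le z₂, abs_nonneg z₁], by
        linarith [le_abs_self z₂, abs_nonneg z₁]⟩)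
      (fun ε₁ ε₂ h1 h2 => hs (hsub hm') _ (hbox s _ _ (by linarith)
        (abs_le.2 ⟨by linarith [(abs_le.1 h1).1], by linarith [(abs_le.1 h1).2]⟩)
        (abs_le.2 ⟨by linarith [(abs_le.1 h2).1], by linarith [(abs_le.1 h2).2]⟩)))
    linarith)
  linarith

/-- Two preimages of `y` give two zeros of its strictly decreasing height, so their arc lengths
agree; the other coordinates are inner products with the same frame. -/
theorem exists_injOn_nhds (h : IsRodFrame L κ x t d n) (hL : 0 ≤ L)
    (hN : ∀ᵐ s, s ∈ Icc 0 L → ∀ ζ ∈ A s, ζ.1 * κ s 1 - ζ.2 * κ s 0 ≤ 1)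
    {q₀ : ℝ × ℝ × ℝ} (hq : q₀ ∈ interior (tube L A)) :
    ∃ U ∈ 𝓝 q₀, InjOn (frameConfig x d n) (U ∩ interior (tube L A)) := by
  obtain ⟨δ, hδ, c, hc, hev⟩ := h.exists_height_decreasing hL hN hq
  have hcont : ContinuousAt (frameConfig x d n) q₀ :=
    (h.continuousOn_config hL A).continuousAt (mem_interior_iff_mem_nhds.1 hq)
  have h1 : ∀ᶠ q : ℝ × ℝ × ℝ in 𝓝 q₀, q.1 ∈ Icc (q₀.1 - δ) (q₀.1 + δ) :=
    continuousAt_fst.eventually (Icc_mem_nhds (by linarith) (by linarith))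
  refine ⟨_, h1.and (hcont.eventually hev), ?_⟩
  have key : ∀ q q' : ℝ × ℝ × ℝ, q.1 ∈ Icc 0 L → q'.1 ∈ Icc 0 L →
      q.1 ∈ Icc (q₀.1 - δ) (q₀.1 + δ) → q'.1 ∈ Icc (q₀.1 - δ) (q₀.1 + δ) →
      (∀ a ∈ Icc (q₀.1 - δ) (q₀.1 + δ), ∀ b ∈ Icc (q₀.1 - δ) (q₀.1 + δ), a ≤ b →
        inner ℝ (t b) (frameConfig x d n q - x b) + c * (b - a) ≤
          inner ℝ (t a) (frameConfig x d n q - x a)) →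
      frameConfig x d n q = frameConfig x d n q' → q.1 ≤ q'.1 → q = q' := by
    intro q q' hqL hqL' hm hm' hy e hle
    have e1 := h.inner_config hqL
    have e2 := h.inner_config hqL'
    rw [← e] at e2
    have := hy _ hm _ hm' hle
    rw [e1.1, e2.1] at this
    have hs : q.1 = q'.1 := by
      by_contra hne
      have : 0 < c * (q'.1 - q.1) := mul_pos hc (sub_pos.2 (lt_of_le_of_ne hle hne))
      linarith
    rw [← hs] at e2
    exact Prod.ext hs (Prod.ext (e1.2.1.symm.trans e2.2.1) (e1.2.2.symm.trans e2.2.2))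
  rintro q ⟨⟨hm, hy⟩, hqi⟩ q' ⟨⟨hm', hy'⟩, hqi'⟩ e
  rcases le_total q.1 q'.1 with hle | hle
  · exact key q q' (interior_subset hqi).1 (interior_subset hqi').1 hm hm' hy e hle
  · exact (key q' q (interior_subset hqi').1 (interior_subset hqi).1 hm' hm hy' e.symm hle).symm

/-- The height of the image of `q₀` is positive just before `q₀.1` and negative just after. Both
signs persist for nearby `y`, so the height of `y` has a zero `s`, and the coordinates of `y` at `s`
give a preimage in `W`. -/
theorem image_mem_nhds (h : IsRodFrame L κ x t d n) (hL : 0 ≤ L)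
    (hN : ∀ᵐ s, s ∈ Icc 0 L → ∀ ζ ∈ A s, ζ.1 * κ s 1 - ζ.2 * κ s 0 ≤ 1)
    {q₀ : ℝ × ℝ × ℝ} (hq : q₀ ∈ interior (tube L A)) {W : Set (ℝ × ℝ × ℝ)} (hW : W ∈ 𝓝 q₀) :
    frameConfig x d n '' W ∈ 𝓝 (frameConfig x d n q₀) := by
  obtain ⟨δ, hδ, c, hc, hev⟩ := h.exists_height_decreasing hL hN hq
  obtain ⟨δ', hδ', hsub, hev'⟩ :=
    h.exists_coords_near hL (fst_mem_nhds_of_mem_interior_tube hq) hW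
  set r := min δ δ'
  have hr : 0 < r := lt_min hδ hδ'
  have hI : Icc (q₀.1 - r) (q₀.1 + r) ⊆ Icc (q₀.1 - δ') (q₀.1 + δ') :=
    Icc_subset_Icc (by linarith [min_le_right δ δ']) (by linarith [min_le_right δ δ'])
  have hI' : Icc (q₀.1 - r) (q₀.1 + r) ⊆ Icc (q₀.1 - δ) (q₀.1 + δ) :=
    Icc_subset_Icc (by linarith [min_le_left δ δ']) (by linarith [min_le_left δ δ'])
  have m1 : q₀.1 - r ∈ Icc (q₀.1 - r) (q₀.1 + r) := ⟨le_rfl, by linarith⟩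
  have m2 : q₀.1 + r ∈ Icc (q₀.1 - r) (q₀.1 + r) := ⟨by linarith, le_rfl⟩
  have m0 : q₀.1 ∈ Icc (q₀.1 - r) (q₀.1 + r) := ⟨by linarith, by linarith⟩
  have hy₀ := hev.self_of_nhds
  have h0 := (h.inner_config (q := q₀) (hsub (hI m0))).1
  have hpos : 0 < inner ℝ (t (q₀.1 - r)) (frameConfig x d n q₀ - x (q₀.1 - r)) := by
    have := hy₀ _ (hI' m1) _ (hI' m0) m0.1
    have : 0 < c * r := by positivity
    nlinarith
  have hneg : inner ℝ (t (q₀.1 + r)) (frameConfig x d n q₀ - x (q₀.1 + r)) < 0 := by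
    have := hy₀ _ (hI' m0) _ (hI' m2) m0.2
    have : 0 < c * r := by positivity
    nlinarith
  have hcy : ∀ s, Continuous fun y : E3 => inner ℝ (t s) (y - x s) := fun s => by fun_prop
  filter_upwards [hev', (hcy _).continuousAt.eventually (lt_mem_nhds hpos),
    (hcy _).continuousAt.eventually (gt_mem_nhds hneg)] with y hyW hy1 hy2
  have hcont : ContinuousOn (fun s => inner ℝ (t s) (y - x s)) (Icc (q₀.1 - r) (q₀.1 + r)) :=
    (((h.continuousOn_t hL).inner (continuousOn_const.sub (h.continuousOn_x hL)))).mono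
      (hI.trans hsub)
  obtain ⟨s, hs, hs0⟩ := intermediate_value_Icc' (by linarith) hcont ⟨hy2.le, hy1.le⟩
  exact ⟨_, hyW s (hI hs), h.config_eq (hsub (hI hs)) hs0⟩

end IsRodFrame

/-! ### Luzin's property N and the volume of the image -/

/-- The indefinite integral of a nonnegative integrable function maps null sets to null sets. -/
theorem volume_image_integral_eq_zero {g : ℝ → ℝ} (hg : Integrable g) (h0 : ∀ s, 0 ≤ g s)
    {Z : Set ℝ} (hZ : volume Z = 0) : volume ((fun s => ∫ r in (0 : ℝ)..s, g r) '' Z) = 0 := by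
  set τ : ℝ → ℝ := fun s => ∫ r in (0 : ℝ)..s, g r with hτ
  have hdiff : ∀ a b, τ b - τ a = ∫ r in a..b, g r := fun a b =>
    intervalIntegral.integral_interval_sub_left hg.intervalIntegrable hg.intervalIntegrable
  have hmono : Monotone τ := fun a b hab => by
    rw [← sub_nonneg, hdiff]
    exact intervalIntegral.integral_nonneg hab fun s _ => h0 s
  have hcont : Continuous τ :=
    intervalIntegral.continuous_primitive (fun a b => hg.intervalIntegrable) 0
  let f : StieltjesFunction ℝ := ⟨τ, hmono, fun s => hcont.continuousWithinAt⟩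
  have hf : f.measure = volume.withDensity fun s => ENNReal.ofReal (g s) := by
    refine Measure.ext_of_Ioc _ _ fun a b hab => ?_
    rw [StieltjesFunction.measure_Ioc, withDensity_apply _ measurableSet_Ioc,
      ← ofReal_integral_eq_lintegral_ofReal hg.integrableOn (.of_forall h0)]
    change ENNReal.ofReal (τ b - τ a) = _
    rw [hdiff, intervalIntegral.integral_of_le hab.le]
  -- The Stieltjes outer measure is the largest one dominated by interval lengths, so the outer
  -- measure `S ↦ |τ(S)|` need only be compared with it on intervals. This avoids any measurability
  -- of `Z`.
  have hle : OuterMeasure.comap τ volume.toOuterMeasure ≤ f.outer := by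
    refine OuterMeasure.le_ofFunction.2 fun S => ?_
    rw [StieltjesFunction.length_eq]
    refine le_iInf fun a => le_iInf fun b => le_iInf fun hS => ?_
    have hS' : S ⊆ Ioc a b := fun s hs => hS ⟨hs, notMem_botSet_of_lt (sub_one_lt s)⟩
    rw [OuterMeasure.comap_apply]
    refine (measure_mono (t := Icc (τ a) (τ b)) ?_).trans (Real.volume_Icc).le
    rintro _ ⟨s, hs, rfl⟩
    exact ⟨hmono (hS' hs).1.le, hmono (hS' hs).2⟩
  have h1 : f.measure Z = 0 := by
    rw [hf]; exact withDensity_absolutelyContinuous _ _ hZ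
  have h2 : f.outer Z = f.measure Z := by
    rw [StieltjesFunction.measure_def]; rfl
  have := hle Z
  rw [OuterMeasure.comap_apply, h2, h1] at this
  exact nonpos_iff_eq_zero.1 this

/-- A map that is Lipschitz after a change of the first coordinate taking values in a null set has
null image. -/
lemma volume_image_eq_zero_of_dist_le {τ : ℝ → ℝ} {F : (Fin 3 → ℝ) → Fin 3 → ℝ}
    {S : Set (Fin 3 → ℝ)} {C : NNReal}
    (hτ : volume (τ '' ((fun v => v 0) '' S)) = 0)
    (hF : ∀ v ∈ S, ∀ w ∈ S, dist (F v) (F w) ≤ C * dist ![τ (v 0), v 1, v 2] ![τ (w 0), w 1, w 2]) :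
    volume (F '' S) = 0 := by
  set T : (Fin 3 → ℝ) → Fin 3 → ℝ := fun v => ![τ (v 0), v 1, v 2] with hT
  have hinv : ∀ v ∈ S, Function.invFunOn T S (T v) ∈ S ∧ T (Function.invFunOn T S (T v)) = T v :=
    fun v hv => ⟨Function.invFunOn_mem ⟨v, hv, rfl⟩, Function.invFunOn_eq ⟨v, hv, rfl⟩⟩
  have hlip : LipschitzOnWith C (F ∘ Function.invFunOn T S) (T '' S) := by
    refine LipschitzOnWith.of_dist_le_mul ?_
    rintro _ ⟨v, hv, rfl⟩ _ ⟨w, hw, rfl⟩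
    have := hF _ (hinv v hv).1 _ (hinv w hw).1
    change _ ≤ C * dist (T _) (T _) at this
    rwa [(hinv v hv).2, (hinv w hw).2] at this
  -- `T` need not be injective, but points with equal `T` have equal `F` by the distance bound, so
  -- the chosen inverse loses nothing.
  have himg : F '' S = (F ∘ Function.invFunOn T S) '' (T '' S) := by
    rw [image_image]
    refine image_congr fun v hv => ?_
    have := hF v hv _ (hinv v hv).1
    change _ ≤ C * dist (T _) (T _) at this
    rw [(hinv v hv).2, dist_self, mul_zero] at this
    exact dist_le_zero.1 this
  have hnull : volume (T '' S) = 0 := by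
    refine measure_mono_null (t := Function.eval 0 ⁻¹' (τ '' ((fun v => v 0) '' S))) ?_
      ((Measure.quasiMeasurePreserving_eval (μ := fun _ : Fin 3 => volume) 0).preimage_null hτ)
    rintro _ ⟨v, hv, rfl⟩
    exact ⟨v 0, ⟨v, hv, rfl⟩, rfl⟩
  have hH := hlip.hausdorffMeasure_image_le (d := 3) (by norm_num)
  have e : (Measure.hausdorffMeasure 3 : Measure (Fin 3 → ℝ)) = volume := by
    rw [← hausdorffMeasure_pi_real]; norm_num
  rw [e, ← himg, hnull, mul_zero] at hH
  exact nonpos_iff_eq_zero.1 hH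

lemma IsPrimitiveOn.abs_sub_le {u u' g : ℝ → ℝ} {a b s r : ℝ} (h : IsPrimitiveOn u u' a b)
    (hg : Integrable g) (hle : ∀ σ ∈ Icc a b, |u' σ| ≤ g σ) (hs : s ∈ Icc a b)
    (hr : r ∈ Icc a b) (hsr : s ≤ r) : |u r - u s| ≤ ∫ σ in s..r, g σ := by
  have hsub : uIcc s r ⊆ uIcc a b := by
    rw [uIcc_of_le hsr, uIcc_of_le (hs.1.trans hs.2)]; exact Icc_subset_Icc hs.1 hr.2
  rw [← (h.mono hsub).integral_eq_sub]
  rw [← Real.norm_eq_abs]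
  refine intervalIntegral.norm_integral_le_of_norm_le hsr (.of_forall fun σ hσ => ?_)
    hg.intervalIntegrable
  exact hle σ ⟨hs.1.trans hσ.1.le, hσ.2.trans hr.2⟩

lemma IsPrimitiveOn.integrable_indicator {u u' : ℝ → ℝ} {a b : ℝ} (h : IsPrimitiveOn u u' a b)
    (hab : a ≤ b) : Integrable ((Icc a b).indicator fun s => |u' s|) := by
  have : IntegrableOn (fun s => |u' s|) (Icc a b) :=
    ((intervalIntegrable_iff_integrableOn_Icc_of_le hab).1 h.intervalIntegrable).abs
  exact this.integrable_indicator measurableSet_Icc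

/-- Finitely many absolutely continuous functions have a common control function. -/
lemma exists_common_modulus {ι : Type*} [Fintype ι] {u u' : ι → ℝ → ℝ} {L : ℝ} (hL : 0 ≤ L)
    (h : ∀ i, IsPrimitiveOn (u i) (u' i) 0 L) :
    ∃ τ : ℝ → ℝ, (∀ Z, volume Z = 0 → volume (τ '' Z) = 0) ∧
      ∀ i, ∀ s ∈ Icc 0 L, ∀ r ∈ Icc 0 L, |u i s - u i r| ≤ |τ s - τ r| := by
  -- The sum of all `|u i'|`, extended by zero: its primitive controls every increment.
  let g : ℝ → ℝ := fun s => ∑ i, (Icc 0 L).indicator (fun s => |u' i s|) s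
  have hpos : ∀ i s, 0 ≤ (Icc 0 L).indicator (fun s => |u' i s|) s := fun i s =>
    indicator_nonneg (fun _ _ => abs_nonneg _) s
  have hg : Integrable g := integrable_finsetSum _ fun i _ => (h i).integrable_indicator hL
  refine ⟨fun s => ∫ r in (0 : ℝ)..s, g r, fun Z hZ => volume_image_integral_eq_zero hg
    (fun s => Finset.sum_nonneg fun i _ => hpos i s) hZ, fun i => ?_⟩
  have hle : ∀ σ ∈ Icc 0 L, |u' i σ| ≤ g σ := fun σ hσ => by
    have := Finset.single_le_sum (fun j _ => hpos j σ) (Finset.mem_univ i)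
    rwa [indicator_of_mem hσ] at this
  have key : ∀ s ∈ Icc 0 L, ∀ r ∈ Icc 0 L, s ≤ r →
      |u i r - u i s| ≤ |(∫ σ in (0 : ℝ)..r, g σ) - ∫ σ in (0 : ℝ)..s, g σ| := by
    intro s hs r hr hsr
    rw [intervalIntegral.integral_interval_sub_left hg.intervalIntegrable hg.intervalIntegrable]
    exact ((h i).abs_sub_le hg hle hs hr hsr).trans (le_abs_self _)
  intro s hs r hr
  rcases le_total s r with hsr | hsr
  · rw [abs_sub_comm, abs_sub_comm (∫ _ in _.._, _)]; exact key s hs r hr hsr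
  · exact key r hr s hs hsr

/-- The configuration map in coordinates. -/
def coordConfig (x d n : ℝ → E3) (v : Fin 3 → ℝ) : Fin 3 → ℝ :=
  fun i => x (v 0) i + v 1 * d (v 0) i + v 2 * n (v 0) i

lemma abs_le_one_of_inner_self {a : E3} (h : inner ℝ a a = 1) (i : Fin 3) : |a i| ≤ 1 := by
  have h1 : ‖a‖ = 1 := by
    rw [real_inner_self_eq_norm_sq] at h
    nlinarith [norm_nonneg a]
  rw [← Real.norm_eq_abs, ← h1]
  exact PiLp.norm_apply_le a i

namespace IsRodFrame

variable {L : ℝ} {κ x t d n : ℝ → E3}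

/-- The part of the rod over a null set of arc lengths has null image. -/
theorem volume_image_coordConfig_eq_zero (h : IsRodFrame L κ x t d n) (hL : 0 ≤ L) {R : ℝ}
    {Z : Set ℝ} (hZ : volume Z = 0) {S : Set (Fin 3 → ℝ)}
    (hS : ∀ v ∈ S, v 0 ∈ Z ∧ v 0 ∈ Icc 0 L ∧ |v 1| ≤ R ∧ |v 2| ≤ R) :
    volume (coordConfig x d n '' S) = 0 := by
  rcases S.eq_empty_or_nonempty with rfl | ⟨v₀, hv₀⟩
  · simp
  have hR : 0 ≤ R := (abs_nonneg _).trans (hS v₀ hv₀).2.2.1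
  obtain ⟨τ, hτ, hmod⟩ := exists_common_modulus (ι := Fin 3 × Fin 3) hL
    (u := fun p => ![fun s => x s p.2, fun s => d s p.2, fun s => n s p.2] p.1)
    (u' := fun p => ![fun s => t s p.2, fun s => (κ s 2 • n s - κ s 1 • t s) p.2,
      fun s => (κ s 0 • t s - κ s 2 • d s) p.2] p.1) (by
      rintro ⟨k, i⟩
      fin_cases k
      · exact h.prim_x i
      · exact h.prim_d i
      · exact h.prim_n i)
  have mx : ∀ i, ∀ s ∈ Icc 0 L, ∀ r ∈ Icc 0 L, |x s i - x r i| ≤ |τ s - τ r| :=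
    fun i => hmod (0, i)
  have md : ∀ i, ∀ s ∈ Icc 0 L, ∀ r ∈ Icc 0 L, |d s i - d r i| ≤ |τ s - τ r| :=
    fun i => hmod (1, i)
  have mn : ∀ i, ∀ s ∈ Icc 0 L, ∀ r ∈ Icc 0 L, |n s i - n r i| ≤ |τ s - τ r| :=
    fun i => hmod (2, i)
  -- The constant collects `1` from the midline, `R` from each director multiplied by a coordinate,
  -- and `1` from each change of a coordinate multiplied by a unit director.
  refine volume_image_eq_zero_of_dist_le (τ := τ) (C := ⟨3 + 2 * R, by positivity⟩) ?_ ?_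
  · refine measure_mono_null (image_mono ?_) (hτ Z hZ)
    rintro _ ⟨v, hv, rfl⟩
    exact (hS v hv).1
  intro v hv w hw
  obtain ⟨-, hv0, hv1, hv2⟩ := hS v hv
  obtain ⟨-, hw0, -, -⟩ := hS w hw
  set D := dist ![τ (v 0), v 1, v 2] ![τ (w 0), w 1, w 2] with hD
  have e0 : |τ (v 0) - τ (w 0)| ≤ D := dist_le_pi_dist (X := fun _ : Fin 3 => ℝ)
    ![τ (v 0), v 1, v 2] ![τ (w 0), w 1, w 2] 0
  have e1 : |v 1 - w 1| ≤ D := dist_le_pi_dist (X := fun _ : Fin 3 => ℝ)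
    ![τ (v 0), v 1, v 2] ![τ (w 0), w 1, w 2] 1
  have e2 : |v 2 - w 2| ≤ D := dist_le_pi_dist (X := fun _ : Fin 3 => ℝ)
    ![τ (v 0), v 1, v 2] ![τ (w 0), w 1, w 2] 2
  have hD0 : 0 ≤ D := dist_nonneg
  refine (dist_pi_le_iff (mul_nonneg (NNReal.coe_nonneg _) hD0)).2 fun i => ?_
  change |coordConfig x d n v i - coordConfig x d n w i| ≤ (3 + 2 * R) * D
  have b1 := (mx i _ hv0 _ hw0).trans e0
  have b2 : |v 1 * (d (v 0) i - d (w 0) i)| ≤ R * D := by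
    rw [abs_mul]; exact mul_le_mul hv1 ((md i _ hv0 _ hw0).trans e0) (abs_nonneg _) hR
  have b3 : |v 2 * (n (v 0) i - n (w 0) i)| ≤ R * D := by
    rw [abs_mul]; exact mul_le_mul hv2 ((mn i _ hv0 _ hw0).trans e0) (abs_nonneg _) hR
  have b4 : |(v 1 - w 1) * d (w 0) i| ≤ D * 1 := by
    rw [abs_mul]
    exact mul_le_mul e1 (abs_le_one_of_inner_self (h.dd _ hw0) i) (abs_nonneg _) hD0
  have b5 : |(v 2 - w 2) * n (w 0) i| ≤ D * 1 := by
    rw [abs_mul]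
    exact mul_le_mul e2 (abs_le_one_of_inner_self (h.nn hw0) i) (abs_nonneg _) hD0
  have e : coordConfig x d n v i - coordConfig x d n w i = (x (v 0) i - x (w 0) i) +
      v 1 * (d (v 0) i - d (w 0) i) + v 2 * (n (v 0) i - n (w 0) i) +
      (v 1 - w 1) * d (w 0) i + (v 2 - w 2) * n (w 0) i := by
    simp only [coordConfig]; ring
  rw [abs_le] at b1 b2 b3 b4 b5 ⊢
  rw [e]
  constructor <;> linarith [b1.1, b1.2, b2.1, b2.2, b3.1, b3.2, b4.1, b4.2, b5.1, b5.2]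

/-- The Jacobian matrix of the configuration map. -/
def jacobianMatrix (κ t d n : ℝ → E3) (v : Fin 3 → ℝ) : Matrix (Fin 3) (Fin 3) ℝ :=
  Matrix.of fun i => ![t (v 0) i + v 1 * (κ (v 0) 2 • n (v 0) - κ (v 0) 1 • t (v 0)) i +
    v 2 * (κ (v 0) 0 • t (v 0) - κ (v 0) 2 • d (v 0)) i, d (v 0) i, n (v 0) i]

/-- The twist `ω` only adds multiples of the columns `d` and `n` to the first column. What remains
is the stated factor times `det(t, d, n) = n · (t × d) = |n|² = 1`. -/
lemma det_jacobianMatrix (h : IsRodFrame L κ x t d n) {v : Fin 3 → ℝ} (hv : v 0 ∈ Icc 0 L) :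
    (jacobianMatrix κ t d n v).det = 1 - v 1 * κ (v 0) 1 + v 2 * κ (v 0) 0 := by
  have h1 := h.nn hv
  have h2 := congr($(h.n_eq (v 0)) 0)
  have h3 := congr($(h.n_eq (v 0)) 1)
  have h4 := congr($(h.n_eq (v 0)) 2)
  simp only [inner_eq_sum, vecCross_zero, vecCross_one, vecCross_two] at h1 h2 h3 h4
  rw [Matrix.det_fin_three]
  simp only [jacobianMatrix, Matrix.of_apply, Matrix.cons_val_zero, Matrix.cons_val_one,
    Matrix.cons_val, PiLp.sub_apply, PiLp.smul_apply, smul_eq_mul]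
  have key : t (v 0) 0 * d (v 0) 1 * n (v 0) 2 - t (v 0) 0 * d (v 0) 2 * n (v 0) 1
      - t (v 0) 1 * d (v 0) 0 * n (v 0) 2 + t (v 0) 2 * d (v 0) 0 * n (v 0) 1
      + t (v 0) 1 * d (v 0) 2 * n (v 0) 0 - t (v 0) 2 * d (v 0) 1 * n (v 0) 0 = 1 := by
    linear_combination h1 - n (v 0) 0 * h2 - n (v 0) 1 * h3 - n (v 0) 2 * h4
  linear_combination (1 - v 1 * κ (v 0) 1 + v 2 * κ (v 0) 0) * key

lemma hasFDerivAt_coordConfig {v : Fin 3 → ℝ}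
    (hx : ∀ i, HasDerivAt (fun s => x s i) (t (v 0) i) (v 0))
    (hd : ∀ i, HasDerivAt (fun s => d s i) ((κ (v 0) 2 • n (v 0) - κ (v 0) 1 • t (v 0)) i) (v 0))
    (hn : ∀ i, HasDerivAt (fun s => n s i) ((κ (v 0) 0 • t (v 0) - κ (v 0) 2 • d (v 0)) i) (v 0)) :
    HasFDerivAt (coordConfig x d n)
      (Matrix.toLin' (jacobianMatrix κ t d n v)).toContinuousLinearMap v := by
  rw [hasFDerivAt_pi']
  intro i
  have p : ∀ j : Fin 3, HasFDerivAt (fun w : Fin 3 → ℝ => w j)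
      (ContinuousLinearMap.proj (R := ℝ) (φ := fun _ : Fin 3 => ℝ) j) v := fun j =>
    (ContinuousLinearMap.proj (R := ℝ) (φ := fun _ : Fin 3 => ℝ) j).hasFDerivAt
  have h1 := (hx i).comp_hasFDerivAt v (p 0)
  have h2 := (p 1).mul ((hd i).comp_hasFDerivAt v (p 0))
  have h3 := (p 2).mul ((hn i).comp_hasFDerivAt v (p 0))
  refine ((h1.add h2).add h3).congr_fderiv ?_
  ext w
  simp [jacobianMatrix, Matrix.mulVec, dotProduct, Fin.sum_univ_three]
  ring

/-- The volume of the image is at most the integral of the Jacobian. -/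
theorem volume_image_coordConfig_le (h : IsRodFrame L κ x t d n) (hL : 0 ≤ L) {R : ℝ}
    {E : Set (Fin 3 → ℝ)} (hE : ∀ v ∈ E, v 0 ∈ Icc 0 L ∧ |v 1| ≤ R ∧ |v 2| ≤ R) :
    volume (coordConfig x d n '' E) ≤
      ∫⁻ v in E, ENNReal.ofReal |1 - v 1 * κ (v 0) 1 + v 2 * κ (v 0) 0| := by
  let B : Set (Fin 3 → ℝ) := {v | v 0 ∈ Icc 0 L ∧ |v 1| ≤ R ∧ |v 2| ≤ R}
  have hB : MeasurableSet B :=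
    ((measurable_pi_apply 0) measurableSet_Icc).inter
      ((measurableSet_le (measurable_pi_apply 1).abs measurable_const).inter
        (measurableSet_le (measurable_pi_apply 2).abs measurable_const))
  have hdiff : ∀ᵐ s, s ∈ Icc 0 L → ∀ i, HasDerivAt (fun s => x s i) (t s i) s ∧
      HasDerivAt (fun s => d s i) ((κ s 2 • n s - κ s 1 • t s) i) s ∧
      HasDerivAt (fun s => n s i) ((κ s 0 • t s - κ s 2 • d s) i) s := by
    have h1 := ae_all_iff.2 fun i => (h.prim_x i).hasDerivAt
    have h2 := ae_all_iff.2 fun i => (h.prim_d i).hasDerivAt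
    have h3 := ae_all_iff.2 fun i => (h.prim_n i).hasDerivAt
    filter_upwards [h1, h2, h3] with s h1 h2 h3 hs i
    rw [← uIcc_of_le hL] at hs
    exact ⟨h1 i hs, h2 i hs, h3 i hs⟩
  obtain ⟨Z, hZsub, hZm, hZ0⟩ := exists_measurable_superset_of_null (ae_iff.1 hdiff)
  -- `E` is arbitrary, while the change-of-variables inequality needs measurability. The measurable
  -- hull carries the same integral, and cutting with `B` retains the bounds.
  set E' := toMeasurable volume E ∩ B with hE'
  have hE'm : MeasurableSet E' := (measurableSet_toMeasurable _ _).inter hB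
  -- The slab over the arc lengths at which some frame function may fail to have its prescribed
  -- derivative; property N makes its image null.
  let P : Set (Fin 3 → ℝ) := {v | v 0 ∈ Z}
  have hP : MeasurableSet P := (measurable_pi_apply 0) hZm
  have hsub : E ⊆ (E' \ P) ∪ (E' ∩ P) := by
    rw [sdiff_union_inter]
    exact fun v hv => ⟨subset_toMeasurable _ _ hv, hE v hv⟩
  have hnull : volume (coordConfig x d n '' (E' ∩ P)) = 0 :=
    h.volume_image_coordConfig_eq_zero hL hZ0 (R := R)
      fun v hv => ⟨hv.2, hv.1.2.1, hv.1.2.2.1, hv.1.2.2.2⟩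
  calc volume (coordConfig x d n '' E)
      ≤ volume (coordConfig x d n '' (E' \ P)) + volume (coordConfig x d n '' (E' ∩ P)) := by
        refine (measure_mono (image_mono hsub)).trans ?_
        rw [image_union]
        exact measure_union_le _ _
    _ ≤ ∫⁻ v in E' \ P, ENNReal.ofReal
          |(Matrix.toLin' (jacobianMatrix κ t d n v)).toContinuousLinearMap.det| := by
        rw [hnull, add_zero]
        refine addHaar_image_le_lintegral_abs_det_fderiv volume (hE'm.diff hP) fun v hv => ?_
        have hg' := not_not.1 (fun hc => hv.2 (hZsub hc)) hv.1.2.1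
        exact (hasFDerivAt_coordConfig (fun i => (hg' i).1) (fun i => (hg' i).2.1)
          fun i => (hg' i).2.2).hasFDerivWithinAt
    _ = ∫⁻ v in E' \ P, ENNReal.ofReal |1 - v 1 * κ (v 0) 1 + v 2 * κ (v 0) 0| := by
        refine setLIntegral_congr_fun (hE'm.diff hP) fun v hv => ?_
        have : (Matrix.toLin' (jacobianMatrix κ t d n v)).toContinuousLinearMap.det =
            (jacobianMatrix κ t d n v).det := by
          rw [LinearMap.det_toContinuousLinearMap, LinearMap.det_toLin']
        simp only [this, h.det_jacobianMatrix hv.1.2.1]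
    _ ≤ ∫⁻ v in toMeasurable volume E, ENNReal.ofReal |1 - v 1 * κ (v 0) 1 + v 2 * κ (v 0) 0| :=
        lintegral_mono_set fun v hv => hv.1.1
    _ = _ := by rw [Measure.restrict_toMeasurable_of_sFinite]

end IsRodFrame

/-! ### Global injectivity -/

/-- Coordinates on `ℝ × ℝ × ℝ`. -/
def tripleCoords (q : ℝ × ℝ × ℝ) : Fin 3 → ℝ := ![q.1, q.2.1, q.2.2]

lemma measurePreserving_tripleCoords : MeasurePreserving tripleCoords := by
  have h1 := (volume_preserving_piFinSuccAbove (fun _ : Fin 3 => ℝ) 0).symm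
  have h2 := (volume_preserving_finTwoArrow ℝ).symm
  have h3 := h1.comp ((MeasurePreserving.id (volume : Measure ℝ)).prod h2)
  convert! h3 using 1
  funext q i
  fin_cases i <;> rfl

lemma measurableEmbedding_tripleCoords : MeasurableEmbedding tripleCoords := by
  have hc : Continuous tripleCoords := by unfold tripleCoords; fun_prop
  refine hc.measurableEmbedding fun p q hpq => ?_
  exact Prod.ext (congr_fun hpq 0) (Prod.ext (congr_fun hpq 1) (congr_fun hpq 2))

theorem IsRodFrame.volume_image_frameConfig_le {L : ℝ} {κ x t d n : ℝ → E3}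
    (h : IsRodFrame L κ x t d n) (hL : 0 ≤ L) {R : ℝ}
    {E : Set (ℝ × ℝ × ℝ)} (hE : ∀ q ∈ E, q.1 ∈ Icc 0 L ∧ |q.2.1| ≤ R ∧ |q.2.2| ≤ R) :
    volume (frameConfig x d n '' E) ≤
      ∫⁻ q in E, ENNReal.ofReal |1 - q.2.1 * κ q.1 1 + q.2.2 * κ q.1 0| := by
  have h1 := h.volume_image_coordConfig_le hL (R := R) (E := tripleCoords '' E) (by
    rintro _ ⟨q, hq, rfl⟩; exact hE q hq)
  rw [← measurePreserving_tripleCoords.setLIntegral_comp_emb measurableEmbedding_tripleCoords] at h1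
  refine le_trans ?_ h1
  have e : coordConfig x d n '' (tripleCoords '' E) =
      WithLp.toLp 2 ⁻¹' (frameConfig x d n '' E) := by
    have hi : (WithLp.toLp 2 : (Fin 3 → ℝ) → E3).Injective := WithLp.toLp_injective 2
    rw [← hi.image_injective.eq_iff, image_preimage_eq _ (WithLp.toLp_surjective 2), image_image,
      image_image]
    refine image_congr fun q _ => ?_
    ext i
    simp [coordConfig, tripleCoords, frameConfig]
  rw [e, (PiLp.volume_preserving_toLp (Fin 3)).measure_preimage_emb
    (MeasurableEquiv.toLp 2 (Fin 3 → ℝ)).measurableEmbedding]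

/-- The global injectivity criterion: a rod whose volume is not larger than the volume it occupies
does not overlap itself. -/
theorem IsRodFrame.injOn_interior {L : ℝ} {κ x t d n : ℝ → E3} {A : ℝ → Set (ℝ × ℝ)}
    (h : IsRodFrame L κ x t d n) (hL : 0 ≤ L)
    (hN : ∀ᵐ s, s ∈ Icc 0 L → ∀ ζ ∈ A s, ζ.1 * κ s 1 - ζ.2 * κ s 0 ≤ 1) {R : ℝ}
    (hR : ∀ s ∈ Icc 0 L, ∀ ζ ∈ A s, |ζ.1| ≤ R ∧ |ζ.2| ≤ R)
    (hfin : ∫⁻ q in tube L A, ENNReal.ofReal |1 - q.2.1 * κ q.1 1 + q.2.2 * κ q.1 0| ≠ ⊤)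
    (hvol : ∫⁻ q in tube L A, ENNReal.ofReal |1 - q.2.1 * κ q.1 1 + q.2.2 * κ q.1 0| ≤
      volume (frameConfig x d n '' tube L A)) :
    InjOn (frameConfig x d n) (interior (tube L A)) := by
  intro q₁ hq₁ q₂ hq₂ heq
  by_contra hne
  obtain ⟨U₁, U₂, hU₁, hU₂, hqU₁, hqU₂, hdisj⟩ := t2_separation hne
  have hopen : frameConfig x d n '' (U₂ ∩ interior (tube L A)) ∈ 𝓝 (frameConfig x d n q₁) := by
    rw [heq]
    exact h.image_mem_nhds hL hN hq₂
      (inter_mem (hU₂.mem_nhds hqU₂) (isOpen_interior.mem_nhds hq₂))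
  obtain ⟨O, hOsub, hO, hyO⟩ := mem_nhds_iff.1 hopen
  -- Every point of `U` has the same image as some point of `U₂`, hence of `Ω \ U`, so `U` can be
  -- removed without changing the image.
  set U := (U₁ ∩ interior (tube L A)) ∩ frameConfig x d n ⁻¹' O with hU
  have hUo : IsOpen U := by
    refine ContinuousOn.isOpen_inter_preimage ?_ (hU₁.inter isOpen_interior) hO
    exact (h.continuousOn_config hL A).mono (inter_subset_right.trans interior_subset)
  have hqU : q₁ ∈ U := ⟨⟨hqU₁, hq₁⟩, hyO⟩
  have hUΩ : U ⊆ tube L A := fun q hq => interior_subset hq.1.2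
  have hcover : frameConfig x d n '' tube L A ⊆ frameConfig x d n '' (tube L A \ U) := by
    rintro _ ⟨q, hq, rfl⟩
    by_cases hqU : q ∈ U
    · obtain ⟨q', hq', e⟩ := hOsub hqU.2
      exact ⟨q', ⟨interior_subset hq'.2, fun hc => disjoint_left.1 hdisj hc.1.1 hq'.1⟩, e⟩
    · exact ⟨q, ⟨hq, hqU⟩, rfl⟩
  have hbox : ∀ q ∈ tube L A, q.1 ∈ Icc 0 L ∧ |q.2.1| ≤ R ∧ |q.2.2| ≤ R :=
    fun q hq => ⟨hq.1, hR q.1 hq.1 q.2 hq.2⟩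
  have h1 := hvol.trans ((measure_mono hcover).trans
    (h.volume_image_frameConfig_le hL fun q hq => hbox q hq.1))
  have h2 := h.volume_image_frameConfig_le hL fun q hq => hbox q (hUΩ hq)
  rw [← lintegral_inter_add_sdiff _ (tube L A) hUo.measurableSet,
    inter_eq_self_of_subset_right hUΩ] at h1
  have hfin' : ∫⁻ q in tube L A \ U,
      ENNReal.ofReal |1 - q.2.1 * κ q.1 1 + q.2.2 * κ q.1 0| ≠ ⊤ :=
    ne_top_of_le_ne_top hfin (lintegral_mono_set sdiff_subset)
  -- Now `∫_U J + ∫_{Ω \ U} J ≤ ∫_{Ω \ U} J`; finiteness permits cancellation.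
  have h3 : ∫⁻ q in U, ENNReal.ofReal |1 - q.2.1 * κ q.1 1 + q.2.2 * κ q.1 0| = 0 := by
    have := ENNReal.le_sub_of_add_le_right hfin' h1
    rwa [tsub_self, nonpos_iff_eq_zero] at this
  rw [h3, nonpos_iff_eq_zero] at h2
  exact (Measure.measure_pos_of_mem_nhds volume
    (h.image_mem_nhds hL hN hq₁ (hUo.mem_nhds hqU))).ne' h2

lemma IsRodFrame.isLocallyInjective {L : ℝ} {κ x t d n : ℝ → E3} {A : ℝ → Set (ℝ × ℝ)}
    (h : IsRodFrame L κ x t d n) (hL : 0 ≤ L)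
    (hN : ∀ᵐ s, s ∈ Icc 0 L → ∀ ζ ∈ A s, ζ.1 * κ s 1 - ζ.2 * κ s 0 ≤ 1) :
    IsLocallyInjective ((interior (tube L A)).domRestrict (frameConfig x d n)) := by
  rintro ⟨q, hq⟩
  obtain ⟨U, hU, hinj⟩ := h.exists_injOn_nhds hL hN hq
  obtain ⟨V, hVU, hV, hqV⟩ := mem_nhds_iff.1 hU
  refine ⟨Subtype.val ⁻¹' V, hV.preimage continuous_subtype_val, hqV, ?_⟩
  intro a ha b hb hab
  exact Subtype.ext (hinj ⟨hVU ha, a.2⟩ ⟨hVU hb, b.2⟩ hab)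

lemma IsRodFrame.isOpenMap {L : ℝ} {κ x t d n : ℝ → E3} {A : ℝ → Set (ℝ × ℝ)}
    (h : IsRodFrame L κ x t d n) (hL : 0 ≤ L)
    (hN : ∀ᵐ s, s ∈ Icc 0 L → ∀ ζ ∈ A s, ζ.1 * κ s 1 - ζ.2 * κ s 0 ≤ 1) :
    IsOpenMap ((interior (tube L A)).domRestrict (frameConfig x d n)) := by
  refine IsOpenMap.of_nhds_le ?_
  rintro ⟨q, hq⟩
  refine le_map fun W hW => ?_
  rw [nhds_subtype_eq_comap] at hW
  obtain ⟨V, hV, hVW⟩ := hW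
  refine mem_of_superset (h.image_mem_nhds hL hN hq
    (inter_mem hV (isOpen_interior.mem_nhds hq))) ?_
  rintro _ ⟨q', hq', rfl⟩
  exact ⟨⟨q', hq'.2⟩, hVW hq'.1, rfl⟩

/-- The Jacobian of a bounded rod is integrable. -/
lemma integrableOn_jacobian {L : ℝ} {κ : ℝ → E3} {A : ℝ → Set (ℝ × ℝ)}
    (hκ : IntegrableOn κ (Icc 0 L)) {R : ℝ}
    (hR : ∀ s ∈ Icc 0 L, ∀ ζ ∈ A s, |ζ.1| ≤ R ∧ |ζ.2| ≤ R) :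
    IntegrableOn (fun q : ℝ × ℝ × ℝ => 1 - q.2.1 * κ q.1 1 + q.2.2 * κ q.1 0) (tube L A) := by
  have hsub : tube L A ⊆ Icc 0 L ×ˢ (Icc (-R) R ×ˢ Icc (-R) R) := fun q hq =>
    ⟨hq.1, abs_le.1 (hR q.1 hq.1 q.2 hq.2).1, abs_le.1 (hR q.1 hq.1 q.2 hq.2).2⟩
  refine IntegrableOn.mono_set ?_ hsub
  have hk : ∀ i, IntegrableOn (fun s => κ s i) (Icc 0 L) := fun i =>
    (EuclideanSpace.proj (𝕜 := ℝ) i).integrable_comp hκ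
  have hc : ∀ g : ℝ × ℝ → ℝ, Continuous g → IntegrableOn g (Icc (-R) R ×ˢ Icc (-R) R) :=
    fun g hg => hg.continuousOn.integrableOn_compact (isCompact_Icc.prod isCompact_Icc)
  have hprod : (volume : Measure (ℝ × ℝ × ℝ)).restrict (Icc 0 L ×ˢ (Icc (-R) R ×ˢ Icc (-R) R)) =
      (volume.restrict (Icc 0 L)).prod (volume.restrict (Icc (-R) R ×ˢ Icc (-R) R)) := by
    rw [Measure.prod_restrict]; rfl
  have h1 := (hk 1).mul_prod (hc Prod.fst continuous_fst)
  have h2 := (hk 0).mul_prod (hc Prod.snd continuous_snd)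
  have h0 : IntegrableOn (fun _ => (1 : ℝ)) (Icc 0 L ×ˢ (Icc (-R) R ×ˢ Icc (-R) R)) :=
    (continuous_const.continuousOn.integrableOn_compact
      (isCompact_Icc.prod (isCompact_Icc.prod isCompact_Icc)))
  rw [← hprod] at h1 h2
  refine ((h0.sub h1).add h2).congr (.of_forall fun q => ?_)
  simp only [Pi.add_apply, Pi.sub_apply]
  ring

/-- The local constraint makes the Jacobian nonnegative almost everywhere on the tube, so the signed
integral in the hypothesis is the integral of the absolute value that appears in the volume bound.
-/
lemma ofReal_integral_jacobian {L : ℝ} {κ : ℝ → E3} {A : ℝ → Set (ℝ × ℝ)}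
    (hκ : IntegrableOn κ (Icc 0 L)) (hA : NullMeasurableSet (tube L A)) {R : ℝ}
    (hR : ∀ s ∈ Icc 0 L, ∀ ζ ∈ A s, |ζ.1| ≤ R ∧ |ζ.2| ≤ R)
    (hN : ∀ᵐ s, s ∈ Icc 0 L → ∀ ζ ∈ A s, ζ.1 * κ s 1 - ζ.2 * κ s 0 ≤ 1) :
    ENNReal.ofReal (∫ q in tube L A, (1 - q.2.1 * κ q.1 1 + q.2.2 * κ q.1 0)) =
      ∫⁻ q in tube L A, ENNReal.ofReal |1 - q.2.1 * κ q.1 1 + q.2.2 * κ q.1 0| := by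
  have hnn : ∀ᵐ q : ℝ × ℝ × ℝ ∂(volume.restrict (tube L A)),
      0 ≤ 1 - q.2.1 * κ q.1 1 + q.2.2 * κ q.1 0 := by
    rw [ae_restrict_iff'₀ hA]
    filter_upwards [Measure.quasiMeasurePreserving_fst.ae hN] with q hq hqA
    linarith [hq hqA.1 q.2 hqA.2]
  rw [ofReal_integral_eq_lintegral_ofReal (integrableOn_jacobian hκ hR) hnn]
  refine lintegral_congr_ae ?_
  filter_upwards [hnn] with q hq
  rw [abs_of_nonneg hq]

/-! ### Application to rods of finite energy -/

namespace KirchhoffRod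

variable {M : KirchhoffRod}

lemma integrableOn_density (w : M.V) : IntegrableOn (density w) (Icc 0 M.L) := by
  refine (Lp.memLp w.1).integrable ?_
  rw [← ENNReal.ofReal_one]
  exact ENNReal.ofReal_le_ofReal M.one_lt_p.le

/-- Existence suffices to validate the choice in `solution`: the geometric argument applies to any
solution with orthonormal initial frame. -/
lemma isRodSolution_solution (w : M.V) (ht : ‖t₀ w‖ = 1) (hd : ‖d₀ w‖ = 1)
    (htd : inner ℝ (t₀ w) (d₀ w) = 0) :
    IsRodSolution M.L (density w) (x₀ w) (t₀ w) (d₀ w) (midline w) (tangent w) (director w) := by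
  obtain ⟨x, t, d, h⟩ :=
    exists_isRodSolution M.L_pos.le (integrableOn_density w) (x₀ w) ht hd htd
  exact Classical.epsilon_spec (p := fun y : (ℝ → E3) × (ℝ → E3) × (ℝ → E3) =>
    IsRodSolution M.L (density w) (x₀ w) (t₀ w) (d₀ w) y.1 y.2.1 y.2.2) ⟨(x, t, d), h⟩

/-- The growth condition bounds the negative part of the integrand by a constant on a bounded
interval. This matters because `⊥ + ⊤ = ⊥` in `EReal`: otherwise an infinite `Eni` could be
absorbed. -/
lemma Esh_ne_bot (w : M.V) : Esh w ≠ ⊥ := by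
  obtain ⟨C₁, hC₁, C₂, hf⟩ := M.growth_f
  have hlt : ∫⁻ s in Icc 0 M.L, (-M.f (density w s) s).toENNReal ≠ ⊤ := by
    refine ne_top_of_le_ne_top (b := ∫⁻ _ in Icc 0 M.L, ENNReal.ofReal (-C₂)) ?_ ?_
    · rw [setLIntegral_const]
      exact ENNReal.mul_ne_top ENNReal.ofReal_ne_top isCompact_Icc.measure_lt_top.ne
    · refine setLIntegral_mono' measurableSet_Icc fun s hs => ?_
      rw [show ENNReal.ofReal (-C₂) = ((-C₂ : ℝ) : EReal).toENNReal from
        (EReal.toENNReal_of_ne_top (EReal.coe_ne_top _)).symm]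
      refine EReal.toENNReal_le_toENNReal ?_
      rw [EReal.coe_neg, EReal.neg_le_neg_iff]
      refine le_trans (EReal.coe_le_coe_iff.2 ?_) (hf (density w s) s hs)
      have := Real.rpow_nonneg (norm_nonneg (density w s)) M.p
      nlinarith [mul_nonneg hC₁.le this]
  rw [Esh, erealIntegral, sub_eq_add_neg, Ne, EReal.add_eq_bot_iff, EReal.neg_eq_bot_iff, not_or]
  exact ⟨EReal.coe_ennreal_ne_bot _, fun h => hlt (EReal.coe_ennreal_eq_top_iff.1 h)⟩

lemma mem_N_of_Eloop_lt_top {w : M.V} (h : Eloop w < ⊤) : w ∈ N (M := M) := by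
  by_contra hw
  rw [Eloop, Eni, if_neg hw, EReal.add_top_of_ne_bot (Esh_ne_bot w), EReal.top_add_coe] at h
  exact lt_irrefl _ h

end KirchhoffRod

theorem mainTheorem4 (M : KirchhoffRod) (w : M.V)
    (ht : ‖KirchhoffRod.t₀ w‖ = 1) (hd : ‖KirchhoffRod.d₀ w‖ = 1)
    (htd : inner ℝ (KirchhoffRod.t₀ w) (KirchhoffRod.d₀ w) = 0)
    (hE : KirchhoffRod.Eloop w < ⊤) :
    IsLocallyInjective ((interior M.Ω).domRestrict (KirchhoffRod.config w)) ∧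
    IsOpenMap ((interior M.Ω).domRestrict (KirchhoffRod.config w)) ∧
    (KirchhoffRod.GlobInj w → Set.InjOn (KirchhoffRod.config w) (interior M.Ω)) := by
  have hL := M.L_pos.le
  have hκ := KirchhoffRod.integrableOn_density w
  have h := (KirchhoffRod.isRodSolution_solution w ht hd htd).isRodFrame hL hκ ht hd htd
  have hN : ∀ᵐ s, s ∈ Icc 0 M.L → ∀ ζ ∈ M.A s,
      ζ.1 * KirchhoffRod.density w s 1 - ζ.2 * KirchhoffRod.density w s 0 ≤ 1 :=
    (ae_restrict_iff' measurableSet_Icc).1 (KirchhoffRod.mem_N_of_Eloop_lt_top hE)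
  -- By definition, `config w` is the `frameConfig` of the midline, the director and `t × d`, and
  -- `M.Ω` is a `tube`.
  refine ⟨h.isLocallyInjective hL hN, h.isOpenMap hL hN, fun hG => ?_⟩
  obtain ⟨R, -, hR⟩ := M.bounded_A
  have hR' : ∀ s ∈ Icc 0 M.L, ∀ ζ ∈ M.A s, |ζ.1| ≤ R ∧ |ζ.2| ≤ R :=
    fun s hs ζ hζ => ⟨(hR s hs ζ hζ).1.le, (hR s hs ζ hζ).2.le⟩
  have e := ofReal_integral_jacobian hκ M.nullMeasurable_A hR' hN
  refine h.injOn_interior hL hN hR' (e ▸ ENNReal.ofReal_ne_top) (e ▸ ?_)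
  have hG' : _ ≤ Measure.euclideanHausdorffMeasure 3 (KirchhoffRod.config w '' M.Ω) := hG
  rwa [EuclideanSpace.euclideanHausdorffMeasure_eq_volume] at hG'
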